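/- Let $L>0$ be such that $L^2$ is not a root of a nonzero polynomial of degree at most $2$ with rational coefficients. Let $a$ be a real-valued function of period $2\pi L$ that is square integrable over a period and has mean zero. Put $\|a\|_{L^2}^2=\int_0^{2\pi L}a^2$, $\hat a(\xi)=(2\pi L)^{-1/2}\int_0^{2\pi L}a(x)e^{-ix\xi}\,dx$ and $\langle\xi\rangle=\sqrt{1+\xi^2}$. All frequencies below, including the summation variables, lie in $\frac1L\mathbb Z^*=\{k/L: k\in\mathbb Z\setminus\{0\}\}$. Let $\omega(x)=\frac{x}{1+x^2}$ and $\Delta^{x}_{y,z}=\omega(x)-\omega(y)-\omega(z)$. **Trees.** Let $\tilde{\mathcal A}_n$ be the set of pairs $(A,\sigma)$, where $A$ is a binary tree with $2n$ internal nodes (hence $2n+1$ leaves), $\sigma$ is a bijection from $\{1,\dots,2n\}$ to the nodes of $A$ such that $\sigma^{-1}(m)\le\sigma^{-1}(m')$ whenever $m$ is a descendant of $m'$, and $\sigma(2j-1)$ is a descendant of $\sigma(2j)$ for $j=1,\dots,n$. For leaf frequencies $\vec\xi=(\xi_1,\dots,\xi_{2n+1})$ and a node $m$, let $\omega_A(m,\vec\xi)=\omega(x)$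 and $\Delta_A(m,\vec\xi)=\Delta^x_{y,z}$, where $x$, $y$, $z$ are the sums of the frequencies of the leaves below $m$, below its left child and below its right child. With $\delta(0)=1$ and $\delta(x)=0$ for $x\ne0$, put $$\hat G_A^\sigma(a)(\xi)=\frac1{(2\pi L)^n}\sum_{\xi_1+\dots+\xi_{2n+1}=\xi}\ \prod_{j=1}^n\frac{\omega_A(\sigma(2j),\vec\xi)\,\omega_A(\sigma(2j-1),\vec\xi)}{i\,\Delta_A(\sigma(2j-1),\vec\xi)}\,\delta\big(\Delta_A(\sigma(2j-1),\vec\xi)+\Delta_A(\sigma(2j),\vec\xi)\big)\prod_{l=1}^{2n+1}\hat a(\xi_l),$$ where the terms with vanishing total frequency below some node are read as $0$. **Coefficients.** For a kernel $w(\xi,\eta)$ define $U_{A,w}^\sigma(a,\xi)$ recursively: it is $1$ if $n=0$; if $n\ge1$, then $\sigma(2n-1)$ is a child of the root, so $A=(A_1,(A_2,A_3))$ with $\sigma(2n-1)$ the right child, or $A=((A_2,A_3),A_1)$ with $\sigma(2n-1)$ the left child, and with the induced orders $\sigma_1,\sigma_2,\sigma_3$, $$U_{A,w}^{\sigma}(a,\xi)=\frac1{2\pi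 L}\sum_{\eta}w(\xi,\eta)\,U_{A_1,w}^{\sigma_1}(a,\eta)\Big(U_{A_2,w}^{\sigma_2}(a,-\eta)U_{A_3,w}^{\sigma_3}(a,\xi)+U_{A_3,w}^{\sigma_3}(a,-\eta)U_{A_2,w}^{\sigma_2}(a,\xi)\Big)|\hat a(\eta)|^2 .$$ Let $$F(\xi,\eta)=\frac1{\omega(\eta)\big(3+\frac{\eta^2+\xi^2+(\xi-\eta)^2}2\big)}\quad\Big(=-\frac{\omega(\xi)\omega(\xi-\eta)}{\Delta^{\xi}_{\eta,\xi-\eta}}\ \text{ for }\eta\neq\xi\Big),$$ $$\tilde F(\xi,\eta)=\frac{\xi(1+\eta^2)}{\big(3+\frac{\eta^2+\xi^2+(\xi-\eta)^2}2\big)\big(3+\frac{\eta^2+\xi^2+(\xi+\eta)^2}2\big)},$$ and let $F^\circ(\xi,\eta)=F(\xi,\eta)$ for $\eta\ne\pm\xi$, $F^\circ(\xi,\xi)=0$, $F^\circ(\xi,-\xi)=\frac12F(\xi,-\xi)$. Put $$U(a,\xi)=\frac2{\pi L}\sum_\eta|\hat a(\eta)|^2\tilde F(\xi,\eta),\qquad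 U^\circ(a,\xi)=U(a,\xi)-\frac{|\hat a(\xi)|^2\,(3+5\xi^2)}{3\pi L\,\xi\,(3+\xi^2)} .$$ **Claim.** There is an absolute constant $C$ such that, for all such $L$ and $a$, every $\xi\in\frac1L\mathbb Z^*$ and every $n\in\mathbb N$: 1. $\displaystyle\sum_{(A,\sigma)\in\tilde{\mathcal A}_n}U_{A,F}^\sigma(a,\xi)=U(a,\xi)^n$. Moreover $U(a,\xi)=\frac2{\pi L}\sum_\eta|\hat a(\eta)|^2F(\xi,\eta)$, both series for $U$ converge absolutely, and $\langle\xi\rangle\,|U(a,\xi)|\le C\|a\|_{L^2}^2/L$. 2. For every $(A,\sigma)\in\tilde{\mathcal A}_n$ the series $\hat G_A^\sigma(a)(\xi)$ converges absolutely and $\hat G_A^\sigma(a)(\xi)=(-i)^n\,U_{A,F^\circ}^\sigma(a,\xi)\,\hat a(\xi)$, where $U_{A,F^\circ}^\sigma(a,\xi)$ is real. Moreover $\displaystyle\sum_{(A,\sigma)\in\tilde{\mathcal A}_n}U_{A,F^\circ}^\sigma(a,\xi)=U^\circ(a,\xi)^n$ and $|\xi|\,|U^\circ(a,\xi)|\le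 C\|a\|_{L^2}^2/L$. -/

import Mathlib

namespace BBM

noncomputable section

/-! Binary trees: internal nodes are called nodes, the `nil` subtrees are the leaves. -/

/-- The node labels of a tree: the root `none`, the nodes `some (.inl m)` of the left subtree
and the nodes `some (.inr m)` of the right subtree. -/
def Node : BinaryTree Unit → Type
  | .nil => Empty
  | .node _ l r => Option (Node l ⊕ Node r)

/-- The leaves of a tree, from left to right. -/
def Leaf : BinaryTree Unit → Type
  | .nil => Unit
  | .node _ l r => Leaf l ⊕ Leaf r

instance Node.instDecidableEq : (A : BinaryTree Unit) → DecidableEq (Node A)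
  | .nil => inferInstanceAs (DecidableEq Empty)
  | .node _ l r =>
    letI := Node.instDecidableEq l
    letI := Node.instDecidableEq r
    inferInstanceAs (DecidableEq (Option (Node l ⊕ Node r)))

instance Node.instFintype : (A : BinaryTree Unit) → Fintype (Node A)
  | .nil => inferInstanceAs (Fintype Empty)
  | .node _ l r =>
    letI := Node.instFintype l
    letI := Node.instFintype r
    inferInstanceAs (Fintype (Option (Node l ⊕ Node r)))

instance Leaf.instFintype : (A : BinaryTree Unit) → Fintype (Leaf A)
  | .nil => inferInstanceAs (Fintype Unit)
  | .node _ l r =>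
    letI := Leaf.instFintype l
    letI := Leaf.instFintype r
    inferInstanceAs (Fintype (Leaf l ⊕ Leaf r))

/-- The parenthood order: `m ≤ j` when `m` lies in the subtree whose root is `j`. -/
def Node.le : (A : BinaryTree Unit) → Node A → Node A → Prop
  | .nil, _, _ => True
  | .node _ _ _, _, none => True
  | .node _ l _, some (.inl m), some (.inl j) => Node.le l m j
  | .node _ _ r, some (.inr m), some (.inr j) => Node.le r m j
  | .node _ _ _, _, _ => False

open Classical in
/-- The ordered paired trees `(A, σ)` with `2n` nodes: `σ` enumerates the nodes of `A` compatibly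
with the parenthood order, and `σ(2j-1) ≤ σ(2j)` for `j = 1, …, n`. The enumeration is
indexed from `0`, so that the `j`-th pair sits at the positions `2j` and `2j+1`, `j < n`. -/
def pairedTrees (n : ℕ) : Finset (Σ A : BinaryTree Unit, Fin (2 * n) ≃ Node A) :=
  (BinaryTree.treesOfNumNodesEq (2 * n)).sigma fun A =>
    Finset.univ.filter fun σ : Fin (2 * n) ≃ Node A =>
      (∀ m j : Node A, Node.le A m j → σ.symm m ≤ σ.symm j) ∧
      ∀ j : Fin n, Node.le A (σ ⟨2 * j, by omega⟩) (σ ⟨2 * j + 1, by omega⟩)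

/-- The dispersion relation. -/
def omega (ξ : ℝ) : ℝ := ξ / (1 + ξ ^ 2)

/-- The resonance function `Δ^ξ_{ξ₁, ξ₂}`. -/
def Delta (ξ ξ₁ ξ₂ : ℝ) : ℝ := omega ξ - omega ξ₁ - omega ξ₂

/-- `ω` at the node `m`, evaluated at the sum of the frequencies of the leaves below `m`. -/
def nodeOmega : (A : BinaryTree Unit) → (Leaf A → ℝ) → Node A → ℝ
  | .nil, _, _ => 0
  | .node _ l r, x, none => omega (∑ i : Leaf (.node () l r), x i)
  | .node _ l _, x, some (.inl m) => nodeOmega l (fun i => x (.inl i)) m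
  | .node _ _ r, x, some (.inr m) => nodeOmega r (fun i => x (.inr i)) m

/-- `Δ` at the node `m`: the total frequency below `m` results from the total frequencies of
its two subtrees. -/
def nodeDelta : (A : BinaryTree Unit) → (Leaf A → ℝ) → Node A → ℝ
  | .nil, _, _ => 0
  | .node _ l r, x, none =>
      Delta (∑ i : Leaf (.node () l r), x i) (∑ i : Leaf l, x (.inl i)) (∑ i : Leaf r, x (.inr i))
  | .node _ l _, x, some (.inl m) => nodeDelta l (fun i => x (.inl i)) m
  | .node _ _ r, x, some (.inr m) => nodeDelta r (fun i => x (.inr i)) m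

/-- The nonzero integers; `k` stands for the frequency `k / L`. -/
abbrev NZ : Type := {k : ℤ // k ≠ 0}

/-- The Fourier coefficient `(2πL)^{-1/2} ∫_{L𝕋} a(x) e^{-ixξ} dx` of a function of period `2πL`. -/
def fourierAt (L : ℝ) (a : ℝ → ℝ) (ξ : ℝ) : ℂ :=
  (1 / Real.sqrt (2 * Real.pi * L) : ℝ) *
    ∫ x in (0 : ℝ)..(2 * Real.pi * L), (a x : ℂ) * Complex.exp (-(Complex.I * x * ξ))

/-- The summand of `Ĝ_A^σ(a)` at the leaf frequencies `x l / L`. A zero denominator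
occurs only where some frequency at a node, hence the product of the numerators, is zero. -/
def treeTerm (L : ℝ) (a : ℝ → ℝ) {n : ℕ} (p : Σ A : BinaryTree Unit, Fin (2 * n) ≃ Node A)
    (x : Leaf p.1 → NZ) : ℂ :=
  let y : Leaf p.1 → ℝ := fun l => (x l : ℤ) / L
  (∏ j : Fin n,
    (nodeOmega p.1 y (p.2 ⟨2 * j + 1, by omega⟩) * nodeOmega p.1 y (p.2 ⟨2 * j, by omega⟩) : ℂ) /
      (Complex.I * nodeDelta p.1 y (p.2 ⟨2 * j, by omega⟩)) *
      (if nodeDelta p.1 y (p.2 ⟨2 * j, by omega⟩) +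
          nodeDelta p.1 y (p.2 ⟨2 * j + 1, by omega⟩) = 0 then 1 else 0)) *
    ∏ l : Leaf p.1, fourierAt L a (y l)

/-- `Ĝ_A^σ(a)(k / L)`, the sum over all nonzero leaf frequencies of total frequency `k / L`. -/
def treeSum (L : ℝ) (a : ℝ → ℝ) {n : ℕ} (p : Σ A : BinaryTree Unit, Fin (2 * n) ≃ Node A)
    (k : ℤ) : ℂ :=
  (1 / (2 * Real.pi * L) ^ n : ℝ) *
    ∑' x : {x : Leaf p.1 → NZ // ∑ l, (x l : ℤ) = k}, treeTerm L a p x.1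

/-- `F(ξ, η)`; it equals `-ω(ξ)ω(ξ-η)/Δ^ξ_{η,ξ-η}` wherever the latter is defined. -/
def F (ξ η : ℝ) : ℝ := 1 / (omega η * (3 + (η ^ 2 + ξ ^ 2 + (ξ - η) ^ 2) / 2))

/-- `F̃(ξ, η)`. -/
def Ftilde (ξ η : ℝ) : ℝ :=
  ξ * (1 + η ^ 2) / ((3 + (η ^ 2 + ξ ^ 2 + (ξ - η) ^ 2) / 2) *
    (3 + (η ^ 2 + ξ ^ 2 + (ξ + η) ^ 2) / 2))

/-- `F` weighted by half the number of pairs `(ξ₂, ξ₃)` with `{ξ₂, ξ₃} = {ξ, -η}` and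
`ξ₂ + ξ₃ ≠ 0`: there are two such pairs in general, one if `η = -ξ` and none if `η = ξ`. -/
def Fexact (ξ η : ℝ) : ℝ :=
  (if η = ξ then 0 else if η = -ξ then 1 / 2 else 1) * F ξ η

/-- One step of the recursion for the coefficients, with kernel `w`. -/
def coeffStep (w : ℝ → ℝ → ℝ) (L : ℝ) (a : ℝ → ℝ) (V₁ V₂ V₃ : ℝ → ℝ) (ξ : ℝ) : ℝ :=
  1 / (2 * Real.pi * L) * ∑' j : NZ,
    w ξ ((j : ℤ) / L) * V₁ ((j : ℤ) / L) *
      (V₂ (-((j : ℤ) / L)) * V₃ ξ + V₃ (-((j : ℤ) / L)) * V₂ ξ) *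
      ‖fourierAt L a ((j : ℤ) / L)‖ ^ 2

/-- The coefficients of an ordered tree. The order of the nodes is given by a rank function, so
that the induced order on a subtree is a restriction. If the node before the root in the order is
the right child of the root, the tree is `(A₁, (A₂, A₃))`; if it is the left child, the tree is
`((A₂, A₃), A₁)`. (The one-node tree gets a dummy value; it never occurs in a paired tree.) -/
def rankedCoeff (w : ℝ → ℝ → ℝ) (L : ℝ) (a : ℝ → ℝ) :
    (A : BinaryTree Unit) → (Node A → ℕ) → ℝ → ℝ
  | .nil, _ => fun _ => 1
  | .node _ .nil .nil, _ => fun _ => 0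
  | .node _ .nil (.node _ A₂ A₃), ρ =>
      coeffStep w L a (fun _ => 1)
        (rankedCoeff w L a A₂ fun m => ρ (some (.inr (some (.inl m)))))
        (rankedCoeff w L a A₃ fun m => ρ (some (.inr (some (.inr m)))))
  | .node _ (.node _ A₂ A₃) .nil, ρ =>
      coeffStep w L a (fun _ => 1)
        (rankedCoeff w L a A₂ fun m => ρ (some (.inl (some (.inl m)))))
        (rankedCoeff w L a A₃ fun m => ρ (some (.inl (some (.inr m)))))
  | .node _ (.node u l₁ l₂) (.node v r₁ r₂), ρ =>
      if ρ (some (.inl none)) < ρ (some (.inr none)) then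
        coeffStep w L a
          (rankedCoeff w L a (.node u l₁ l₂) fun m => ρ (some (.inl m)))
          (rankedCoeff w L a r₁ fun m => ρ (some (.inr (some (.inl m)))))
          (rankedCoeff w L a r₂ fun m => ρ (some (.inr (some (.inr m)))))
      else
        coeffStep w L a
          (rankedCoeff w L a (.node v r₁ r₂) fun m => ρ (some (.inr m)))
          (rankedCoeff w L a l₁ fun m => ρ (some (.inl (some (.inl m)))))
          (rankedCoeff w L a l₂ fun m => ρ (some (.inl (some (.inr m)))))

/-- The coefficient `U_A^σ(a, ξ)` with kernel `w`. -/
def treeCoeff (w : ℝ → ℝ → ℝ) (L : ℝ) (a : ℝ → ℝ) {n : ℕ}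
    (p : Σ A : BinaryTree Unit, Fin (2 * n) ≃ Node A) (ξ : ℝ) : ℝ :=
  rankedCoeff w L a p.1 (fun m => (p.2.symm m : ℕ)) ξ

/-- `U(a, ξ) = 2/(πL) ∑_η |â(η)|² F̃(ξ, η)`. -/
def U (L : ℝ) (a : ℝ → ℝ) (ξ : ℝ) : ℝ :=
  2 / (Real.pi * L) * ∑' j : NZ, ‖fourierAt L a ((j : ℤ) / L)‖ ^ 2 * Ftilde ξ ((j : ℤ) / L)

/-- `U(a, ξ)` with its diagonal contributions `η = ±ξ` counted with the exact multiplicity. -/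
def Uexact (L : ℝ) (a : ℝ → ℝ) (ξ : ℝ) : ℝ :=
  U L a ξ - ‖fourierAt L a ξ‖ ^ 2 * (3 + 5 * ξ ^ 2) / (3 * Real.pi * L * ξ * (3 + ξ ^ 2))

end

end BBM

/-! Trees. In a paired tree the lower node of each pair turns out to be a child of the upper one.
Contracting every pair gives a ternary tree (`PairTree`) whose vertices carry the pair index,
strictly decreasing away from the root, and one bit for the side of the lower node. This is a
bijection (`sum_pairedTrees`), and both the coefficients and the terms of the tree sums become plain
recursions on ternary trees.

Sum of the coefficients. The largest label sits at the root and the other labels are distributed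
freely over the three subtrees. Write `W` for `U` or `Uexact`. By induction, subtrees with `p`, `q`,
`r` labels contribute `W(η)^p (W(-η)^q W(ξ)^r + W(-η)^r W(ξ)^q)`. Summed over all distributions this
is twice `(W(η) + W(-η) + W(ξ))^(n-1)` by the multinomial theorem, and since `W` is odd it collapses
to `2 W(ξ)^(n-1)`, free of `η`. The remaining sum over `η` of the kernel is `W(ξ)` itself
(`PairTree.sum_coeff`). The argument needs only an odd `W` that is the series of its bounded kernel;
`hasSum_U_F` and `hasSum_Uexact` supply the two instances.

Tree sums. Clearing denominators in `Δ + Δ = 0` gives a quadratic equation for `L^2` with integer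
coefficients and leading coefficient `-3(k₁+k₂)(k₁+k₃)(k₂+k₃)`. By the assumption on `L` it
vanishes, so one child of the lower node has frequency `-ξ₁` and the other has `ξ`. There the factor
of the pair is `-iF(ξ, ξ₁)`, and counting the two pairings correctly on the diagonals replaces `F`
by `Fexact` (`ite_pairFactor`). Summation over the leaves is an induction in which convergence is
the issue, as the data are only square summable. The invariant `FibreSum` bounds the absolute sum at
total frequency `k` by a multiple of `|â(k/L)|`; the two paired subtrees then provide a factor
`|â(η)|^2`, which is summable. -/

namespace BBM

open Finset
open scoped ENNReal NNReal

/-! ### Paired trees as labelled ternary trees. -/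

/-- Ternary trees whose internal vertices carry a label and an orientation. A vertex labelled `j`
stands for the `j`-th pair of nodes of a paired tree; the orientation tells whether the lower node
of the pair is the right (`true`) or the left (`false`) child of the upper one. -/
inductive PairTree : Type
  | leaf : PairTree
  | graft (b : Bool) (j : ℕ) (t₁ t₂ t₃ : PairTree) : PairTree

namespace PairTree

/-- The underlying binary tree. -/
def toTree : PairTree → BinaryTree Unit
  | leaf => .nil
  | graft true _ t₁ t₂ t₃ => .node () t₁.toTree (.node () t₂.toTree t₃.toTree)
  | graft false _ t₁ t₂ t₃ => .node () (.node () t₂.toTree t₃.toTree) t₁.toTree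

/-- The position of a node in the order: the pair labelled `j` sits at `2j` and `2j+1`. -/
def rank : (t : PairTree) → Node t.toTree → ℕ
  | leaf, m => nomatch m
  | graft true j _ _ _, none => 2 * j + 1
  | graft true j _ _ _, some (.inr none) => 2 * j
  | graft true _ t₁ _ _, some (.inl m) => t₁.rank m
  | graft true _ _ t₂ _, some (.inr (some (.inl m))) => t₂.rank m
  | graft true _ _ _ t₃, some (.inr (some (.inr m))) => t₃.rank m
  | graft false j _ _ _, none => 2 * j + 1
  | graft false j _ _ _, some (.inl none) => 2 * j
  | graft false _ t₁ _ _, some (.inr m) => t₁.rank m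
  | graft false _ _ t₂ _, some (.inl (some (.inl m))) => t₂.rank m
  | graft false _ _ _ t₃, some (.inl (some (.inr m))) => t₃.rank m

/-- The set of labels. -/
def labels : PairTree → Finset ℕ
  | leaf => ∅
  | graft _ j t₁ t₂ t₃ => insert j (t₁.labels ∪ t₂.labels ∪ t₃.labels)

/-- The labels are distinct and decrease away from the root. -/
def Decreasing : PairTree → Prop
  | leaf => True
  | graft _ j t₁ t₂ t₃ =>
    (t₁.Decreasing ∧ t₂.Decreasing ∧ t₃.Decreasing) ∧
    ((∀ i ∈ t₁.labels, i < j) ∧ (∀ i ∈ t₂.labels, i < j) ∧ ∀ i ∈ t₃.labels, i < j) ∧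
    Disjoint t₁.labels t₂.labels ∧ Disjoint t₁.labels t₃.labels ∧ Disjoint t₂.labels t₃.labels

/-- The value of a function of pairs of nodes at the pair labelled `j`, or `1` if there is none. -/
def pairAt {M : Type*} [CommMonoid M] :
    (t : PairTree) → (Node t.toTree → Node t.toTree → M) → ℕ → M
  | leaf, _, _ => 1
  | graft true j t₁ t₂ t₃, g, i =>
    if i = j then g (some (.inr none)) none else
      t₁.pairAt (fun m m' => g (some (.inl m)) (some (.inl m'))) i *
      t₂.pairAt (fun m m' => g (some (.inr (some (.inl m)))) (some (.inr (some (.inl m'))))) i *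
      t₃.pairAt (fun m m' => g (some (.inr (some (.inr m)))) (some (.inr (some (.inr m'))))) i
  | graft false j t₁ t₂ t₃, g, i =>
    if i = j then g (some (.inl none)) none else
      t₁.pairAt (fun m m' => g (some (.inr m)) (some (.inr m'))) i *
      t₂.pairAt (fun m m' => g (some (.inl (some (.inl m)))) (some (.inl (some (.inl m'))))) i *
      t₃.pairAt (fun m m' => g (some (.inl (some (.inr m)))) (some (.inl (some (.inr m'))))) i

/-- The product over all pairs of nodes. -/
def pairProd {M : Type*} [CommMonoid M] :
    (t : PairTree) → (Node t.toTree → Node t.toTree → M) → M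
  | leaf, _ => 1
  | graft true _ t₁ t₂ t₃, g =>
    g (some (.inr none)) none *
      (t₁.pairProd (fun m m' => g (some (.inl m)) (some (.inl m'))) *
      t₂.pairProd (fun m m' => g (some (.inr (some (.inl m)))) (some (.inr (some (.inl m'))))) *
      t₃.pairProd (fun m m' => g (some (.inr (some (.inr m)))) (some (.inr (some (.inr m'))))))
  | graft false _ t₁ t₂ t₃, g =>
    g (some (.inl none)) none *
      (t₁.pairProd (fun m m' => g (some (.inr m)) (some (.inr m'))) *
      t₂.pairProd (fun m m' => g (some (.inl (some (.inl m)))) (some (.inl (some (.inl m'))))) *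
      t₃.pairProd (fun m m' => g (some (.inl (some (.inr m)))) (some (.inl (some (.inr m'))))))

theorem rank_div_two_mem : ∀ (t : PairTree) (m : Node t.toTree), t.rank m / 2 ∈ t.labels
  | leaf, m => nomatch m
  | graft true j t₁ t₂ t₃, m => by
    rcases m with _ | (m | (_ | (m | m))) <;> simp only [rank, labels, mem_insert, mem_union]
    · left; omega
    · exact Or.inr (Or.inl (Or.inl (rank_div_two_mem t₁ m)))
    · left; omega
    · exact Or.inr (Or.inl (Or.inr (rank_div_two_mem t₂ m)))
    · exact Or.inr (Or.inr (rank_div_two_mem t₃ m))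
  | graft false j t₁ t₂ t₃, m => by
    rcases m with _ | ((_ | (m | m)) | m) <;> simp only [rank, labels, mem_insert, mem_union]
    · left; omega
    · left; omega
    · exact Or.inr (Or.inl (Or.inr (rank_div_two_mem t₂ m)))
    · exact Or.inr (Or.inr (rank_div_two_mem t₃ m))
    · exact Or.inr (Or.inl (Or.inl (rank_div_two_mem t₁ m)))

theorem pairAt_of_notMem {M : Type*} [CommMonoid M] : ∀ (t : PairTree)
    (g : Node t.toTree → Node t.toTree → M) (i : ℕ), i ∉ t.labels → t.pairAt g i = 1
  | leaf, _, _, _ => rfl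
  | graft true j t₁ t₂ t₃, g, i, h => by
    simp only [labels, mem_insert, mem_union, not_or] at h
    rw [pairAt, if_neg h.1, pairAt_of_notMem t₁ _ i h.2.1.1, pairAt_of_notMem t₂ _ i h.2.1.2,
      pairAt_of_notMem t₃ _ i h.2.2, mul_one, mul_one]
  | graft false j t₁ t₂ t₃, g, i, h => by
    simp only [labels, mem_insert, mem_union, not_or] at h
    rw [pairAt, if_neg h.1, pairAt_of_notMem t₁ _ i h.2.1.1, pairAt_of_notMem t₂ _ i h.2.1.2,
      pairAt_of_notMem t₃ _ i h.2.2, mul_one, mul_one]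

/-- Each `fᵢ` is `1` off its own set, so a product over the union may be restricted factor by
factor; the sets need not be disjoint. The strict bounds keep `j` out of the union. -/
theorem prod_labels_mul {M : Type*} [CommMonoid M] {j : ℕ} {S₁ S₂ S₃ : Finset ℕ}
    (h₁ : ∀ i ∈ S₁, i < j) (h₂ : ∀ i ∈ S₂, i < j) (h₃ : ∀ i ∈ S₃, i < j)
    (c : M)
    {f₁ f₂ f₃ : ℕ → M} (e₁ : ∀ i ∉ S₁, f₁ i = 1) (e₂ : ∀ i ∉ S₂, f₂ i = 1)
    (e₃ : ∀ i ∉ S₃, f₃ i = 1) :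
    ∏ i ∈ insert j (S₁ ∪ S₂ ∪ S₃), (if i = j then c else f₁ i * f₂ i * f₃ i) =
      c * ((∏ i ∈ S₁, f₁ i) * (∏ i ∈ S₂, f₂ i) * ∏ i ∈ S₃, f₃ i) := by
  rw [prod_insert, if_pos rfl]
  · congr 1
    rw [prod_congr rfl (g := fun i => f₁ i * f₂ i * f₃ i)]
    · rw [prod_mul_distrib, prod_mul_distrib]
      congr 1
      · congr 1
        · refine (prod_subset (fun i hi => by simp [hi]) fun i _ hi => e₁ i hi).symm
        · refine (prod_subset (fun i hi => by simp [hi]) fun i _ hi => e₂ i hi).symm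
      · refine (prod_subset (fun i hi => by simp [hi]) fun i _ hi => e₃ i hi).symm
    · intro i hi
      rw [if_neg]
      rintro rfl
      simp only [mem_union] at hi
      rcases hi with (hi | hi) | hi
      · exact lt_irrefl _ (h₁ _ hi)
      · exact lt_irrefl _ (h₂ _ hi)
      · exact lt_irrefl _ (h₃ _ hi)
  · simp only [mem_union]
    rintro ((hi | hi) | hi)
    · exact lt_irrefl _ (h₁ _ hi)
    · exact lt_irrefl _ (h₂ _ hi)
    · exact lt_irrefl _ (h₃ _ hi)

theorem prod_pairAt {M : Type*} [CommMonoid M] : ∀ (t : PairTree)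
    (g : Node t.toTree → Node t.toTree → M), t.Decreasing →
    ∏ i ∈ t.labels, t.pairAt g i = t.pairProd g
  | leaf, _, _ => rfl
  | graft true j t₁ t₂ t₃, g, ⟨⟨d₁, d₂, d₃⟩, ⟨l₁, l₂, l₃⟩, _⟩ => by
    simp only [labels, pairAt, pairProd]
    rw [prod_labels_mul l₁ l₂ l₃ _ (fun i => pairAt_of_notMem t₁ _ i)
      (fun i => pairAt_of_notMem t₂ _ i) (fun i => pairAt_of_notMem t₃ _ i),
      prod_pairAt t₁ _ d₁, prod_pairAt t₂ _ d₂, prod_pairAt t₃ _ d₃]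
  | graft false j t₁ t₂ t₃, g, ⟨⟨d₁, d₂, d₃⟩, ⟨l₁, l₂, l₃⟩, _⟩ => by
    simp only [labels, pairAt, pairProd]
    rw [prod_labels_mul l₁ l₂ l₃ _ (fun i => pairAt_of_notMem t₁ _ i)
      (fun i => pairAt_of_notMem t₂ _ i) (fun i => pairAt_of_notMem t₃ _ i),
      prod_pairAt t₁ _ d₁, prod_pairAt t₂ _ d₂, prod_pairAt t₃ _ d₃]

/-- Disjointness of the three label sets turns all but one factor of `pairAt` into `1`. The nodes do
not depend on `g`; where only their ranks matter, the lemma is applied with the dummy choice `M :=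
ℕ`. -/
theorem exists_pair {M : Type*} [CommMonoid M] : ∀ (t : PairTree), t.Decreasing →
    ∀ i ∈ t.labels, ∃ m m' : Node t.toTree, t.rank m = 2 * i ∧ t.rank m' = 2 * i + 1 ∧
      Node.le t.toTree m m' ∧
      ∀ g : Node t.toTree → Node t.toTree → M, t.pairAt g i = g m m'
  | leaf, _, i, hi => by simp [labels] at hi
  | graft b j t₁ t₂ t₃, ⟨⟨d₁, d₂, d₃⟩, ⟨l₁, l₂, l₃⟩, h₁₂, h₁₃, h₂₃⟩, i, hi => by
    simp only [labels, mem_insert, mem_union] at hi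
    rcases hi with rfl | (hi | hi) | hi
    · cases b
      · exact ⟨some (.inl none), none, rfl, rfl, trivial, fun g => if_pos rfl⟩
      · exact ⟨some (.inr none), none, rfl, rfl, trivial, fun g => if_pos rfl⟩
    · obtain ⟨m, m', hm, hm', hle, hg⟩ := exists_pair (M := M) t₁ d₁ i hi
      have n₂ := disjoint_left.1 h₁₂ hi
      have n₃ := disjoint_left.1 h₁₃ hi
      cases b
      · refine ⟨some (.inr m), some (.inr m'), hm, hm', hle, fun g => ?_⟩
        rw [pairAt, if_neg (l₁ i hi).ne, hg, pairAt_of_notMem t₂ _ i n₂,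
          pairAt_of_notMem t₃ _ i n₃, mul_one, mul_one]
      · refine ⟨some (.inl m), some (.inl m'), hm, hm', hle, fun g => ?_⟩
        rw [pairAt, if_neg (l₁ i hi).ne, hg, pairAt_of_notMem t₂ _ i n₂,
          pairAt_of_notMem t₃ _ i n₃, mul_one, mul_one]
    · obtain ⟨m, m', hm, hm', hle, hg⟩ := exists_pair (M := M) t₂ d₂ i hi
      have n₁ := disjoint_right.1 h₁₂ hi
      have n₃ := disjoint_left.1 h₂₃ hi
      cases b
      · refine ⟨some (.inl (some (.inl m))), some (.inl (some (.inl m'))), hm, hm', hle,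
          fun g => ?_⟩
        rw [pairAt, if_neg (l₂ i hi).ne, hg, pairAt_of_notMem t₁ _ i n₁,
          pairAt_of_notMem t₃ _ i n₃, mul_one, one_mul]
      · refine ⟨some (.inr (some (.inl m))), some (.inr (some (.inl m'))), hm, hm', hle,
          fun g => ?_⟩
        rw [pairAt, if_neg (l₂ i hi).ne, hg, pairAt_of_notMem t₁ _ i n₁,
          pairAt_of_notMem t₃ _ i n₃, mul_one, one_mul]
    · obtain ⟨m, m', hm, hm', hle, hg⟩ := exists_pair (M := M) t₃ d₃ i hi
      have n₁ := disjoint_right.1 h₁₃ hi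
      have n₂ := disjoint_right.1 h₂₃ hi
      cases b
      · refine ⟨some (.inl (some (.inr m))), some (.inl (some (.inr m'))), hm, hm', hle,
          fun g => ?_⟩
        rw [pairAt, if_neg (l₃ i hi).ne, hg, pairAt_of_notMem t₁ _ i n₁,
          pairAt_of_notMem t₂ _ i n₂, one_mul, one_mul]
      · refine ⟨some (.inr (some (.inr m))), some (.inr (some (.inr m'))), hm, hm', hle,
          fun g => ?_⟩
        rw [pairAt, if_neg (l₃ i hi).ne, hg, pairAt_of_notMem t₁ _ i n₁,
          pairAt_of_notMem t₂ _ i n₂, one_mul, one_mul]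

end PairTree

theorem card_node : ∀ A : BinaryTree Unit, Fintype.card (Node A) = A.numNodes
  | .nil => rfl
  | .node _ l r => by
    have : Fintype.card (Node (.node () l r)) = Fintype.card (Option (Node l ⊕ Node r)) := rfl
    rw [BinaryTree.numNodes, ← card_node l, ← card_node r]
    exact this.trans (by simp)

namespace PairTree

theorem card_labels : ∀ t : PairTree, t.Decreasing → t.toTree.numNodes = 2 * t.labels.card
  | leaf, _ => rfl
  | graft b j t₁ t₂ t₃, ⟨⟨d₁, d₂, d₃⟩, ⟨l₁, l₂, l₃⟩, h₁₂, h₁₃, h₂₃⟩ => by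
    have h : (graft b j t₁ t₂ t₃).labels.card =
        t₁.labels.card + t₂.labels.card + t₃.labels.card + 1 := by
      rw [labels, card_insert_of_notMem, card_union_of_disjoint, card_union_of_disjoint h₁₂]
      · exact disjoint_union_left.2 ⟨h₁₃, h₂₃⟩
      · simp only [mem_union]
        rintro ((hi | hi) | hi)
        · exact lt_irrefl _ (l₁ _ hi)
        · exact lt_irrefl _ (l₂ _ hi)
        · exact lt_irrefl _ (l₃ _ hi)
    have e₁ := card_labels t₁ d₁
    have e₂ := card_labels t₂ d₂
    have e₃ := card_labels t₃ d₃
    rw [h]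
    cases b <;> simp only [toTree, BinaryTree.numNodes] <;> omega

/-- By counting: every label `j` produces the two ranks `2j` and `2j+1`, and the tree has only twice
as many nodes as labels. -/
theorem rank_injective (t : PairTree) (ht : t.Decreasing) : Function.Injective t.rank := by
  have hsub : (t.labels ×ˢ (range 2)).image (fun x => 2 * x.1 + x.2) ⊆ univ.image t.rank := by
    intro i hi
    obtain ⟨⟨j, e⟩, hj, rfl⟩ := mem_image.1 hi
    obtain ⟨hj, he⟩ := mem_product.1 hj
    obtain ⟨m, m', hm, hm', -⟩ := exists_pair (M := ℕ) t ht j hj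
    have : e = 0 ∨ e = 1 := by have := mem_range.1 he; omega
    rcases this with rfl | rfl
    · exact mem_image.2 ⟨m, mem_univ _, hm⟩
    · exact mem_image.2 ⟨m', mem_univ _, hm'⟩
  have hcard := card_le_card hsub
  rw [card_image_of_injOn, card_product, card_range] at hcard
  · have h2 : (univ : Finset (Node t.toTree)).card ≤ (univ.image t.rank).card := by
      rw [card_univ, card_node, card_labels t ht]; omega
    have := card_image_iff.1 (le_antisymm card_image_le h2)
    simpa using this
  · rintro ⟨j, e⟩ h ⟨j', e'⟩ h' heq
    simp only [coe_product, Set.mem_prod, mem_coe, mem_range] at h h' heq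
    ext <;> simp <;> omega

/-- Labels below a vertex labelled `j` are smaller than `j`, so all ranks in its subtrees are below
`2j`. -/
theorem rank_mono : ∀ (t : PairTree), t.Decreasing → ∀ m m' : Node t.toTree,
    Node.le t.toTree m m' → t.rank m ≤ t.rank m'
  | leaf, _, m, _, _ => nomatch m
  | graft true j t₁ t₂ t₃, ⟨⟨d₁, d₂, d₃⟩, ⟨l₁, l₂, l₃⟩, _⟩, m, m', h => by
    have r₁ := fun m => l₁ _ (rank_div_two_mem t₁ m)
    have r₂ := fun m => l₂ _ (rank_div_two_mem t₂ m)
    have r₃ := fun m => l₃ _ (rank_div_two_mem t₃ m)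
    rcases m with _ | (m | (_ | (m | m))) <;> rcases m' with _ | (m' | (_ | (m' | m'))) <;>
      first
      | exact h.elim
      | exact rank_mono t₁ d₁ _ _ h
      | exact rank_mono t₂ d₂ _ _ h
      | exact rank_mono t₃ d₃ _ _ h
      | (simp only [rank]; have := r₁ m; omega)
      | (simp only [rank]; have := r₂ m; omega)
      | (simp only [rank]; have := r₃ m; omega)
      | (simp only [rank]; omega)
  | graft false j t₁ t₂ t₃, ⟨⟨d₁, d₂, d₃⟩, ⟨l₁, l₂, l₃⟩, _⟩, m, m', h => by
    have r₁ := fun m => l₁ _ (rank_div_two_mem t₁ m)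
    have r₂ := fun m => l₂ _ (rank_div_two_mem t₂ m)
    have r₃ := fun m => l₃ _ (rank_div_two_mem t₃ m)
    rcases m with _ | ((_ | (m | m)) | m) <;> rcases m' with _ | ((_ | (m' | m')) | m') <;>
      first
      | exact h.elim
      | exact rank_mono t₁ d₁ _ _ h
      | exact rank_mono t₂ d₂ _ _ h
      | exact rank_mono t₃ d₃ _ _ h
      | (simp only [rank]; have := r₁ m; omega)
      | (simp only [rank]; have := r₂ m; omega)
      | (simp only [rank]; have := r₃ m; omega)
      | (simp only [rank]; omega)

end PairTree

/-! ### From ordered binary trees back to ternary trees. -/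

/-- A rank function on the nodes of a tree that enumerates it in comparable pairs, compatibly
with the parenthood order. -/
structure IsPairing (A : BinaryTree Unit) (ρ : Node A → ℕ) : Prop where
  injective : Function.Injective ρ
  mono : ∀ m m', Node.le A m m' → ρ m ≤ ρ m'
  partner : ∀ m, ∃ m', ρ m' ≠ ρ m ∧ ρ m' / 2 = ρ m / 2 ∧ (Node.le A m m' ∨ Node.le A m' m)

/-- The closure condition `hcl` says that the partner of an embedded node is embedded as well, so no
pair is cut apart. -/
theorem IsPairing.restrict {A B : BinaryTree Unit} {ρ : Node A → ℕ} (h : IsPairing A ρ)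
    (e : Node B → Node A) (he : Function.Injective e)
    (hle : ∀ m m', Node.le A (e m) (e m') ↔ Node.le B m m')
    (hcl : ∀ m m', Node.le A (e m) m' ∨ Node.le A m' (e m) → ρ m' / 2 = ρ (e m) / 2 →
      ∃ m'', e m'' = m') : IsPairing B (fun m => ρ (e m)) where
  injective := h.injective.comp he
  mono m m' hm := h.mono _ _ ((hle m m').2 hm)
  partner m := by
    obtain ⟨m', h1, h2, h3⟩ := h.partner (e m)
    obtain ⟨m'', rfl⟩ := hcl m m' h3 h2
    exact ⟨m'', h1, h2, by rwa [hle, hle] at h3⟩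

theorem Node.le_root {l r : BinaryTree Unit} (m : Node (.node () l r)) :
    Node.le (.node () l r) m none := by
  rcases m with _ | (m | m) <;> trivial

/-- The pair `j` is used up by the root and its right child. Any other pair consists of comparable
nodes, and nodes of different subtrees are not comparable, so each pair stays inside one of the
three subtrees. -/
theorem IsPairing.of_right {A₁ A₂ A₃ : BinaryTree Unit}
    {ρ : Node (.node () A₁ (.node () A₂ A₃)) → ℕ} (h : IsPairing _ ρ) {j : ℕ}
    (h₀ : ρ none = 2 * j + 1) (h₁ : ρ (some (.inr none)) = 2 * j) :
    IsPairing A₁ (fun m => ρ (some (.inl m))) ∧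
    IsPairing A₂ (fun m => ρ (some (.inr (some (.inl m))))) ∧
    IsPairing A₃ (fun m => ρ (some (.inr (some (.inr m))))) := by
  have key : ∀ m, ρ m / 2 = j → m = none ∨ m = some (.inr none) := by
    intro m hm
    have : ρ m = 2 * j + 1 ∨ ρ m = 2 * j := by omega
    rcases this with e | e
    · exact Or.inl (h.injective (e.trans h₀.symm))
    · exact Or.inr (h.injective (e.trans h₁.symm))
  refine ⟨h.restrict _ ?_ (fun _ _ => Iff.rfl) ?_, h.restrict _ ?_ (fun _ _ => Iff.rfl) ?_,
    h.restrict _ ?_ (fun _ _ => Iff.rfl) ?_⟩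
  · exact (Option.some_injective _).comp Sum.inl_injective
  · rintro m (_ | (m' | (_ | (m' | m')))) hm hq
    · exact (key _ (hq.symm.trans (by omega))).elim nofun nofun
    · exact ⟨m', rfl⟩
    · exact (key _ (hq.symm.trans (by omega))).elim nofun nofun
    · exact (hm.elim id id).elim
    · exact (hm.elim id id).elim
  · exact (Option.some_injective _).comp (Sum.inr_injective.comp
      ((Option.some_injective _).comp Sum.inl_injective))
  · rintro m (_ | (m' | (_ | (m' | m')))) hm hq
    · exact (key _ (hq.symm.trans (by omega))).elim nofun nofun
    · exact (hm.elim id id).elim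
    · exact (key _ (hq.symm.trans (by omega))).elim nofun nofun
    · exact ⟨m', rfl⟩
    · exact (hm.elim id id).elim
  · exact (Option.some_injective _).comp (Sum.inr_injective.comp
      ((Option.some_injective _).comp Sum.inr_injective))
  · rintro m (_ | (m' | (_ | (m' | m')))) hm hq
    · exact (key _ (hq.symm.trans (by omega))).elim nofun nofun
    · exact (hm.elim id id).elim
    · exact (key _ (hq.symm.trans (by omega))).elim nofun nofun
    · exact (hm.elim id id).elim
    · exact ⟨m', rfl⟩

theorem IsPairing.of_left {A₁ A₂ A₃ : BinaryTree Unit}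
    {ρ : Node (.node () (.node () A₂ A₃) A₁) → ℕ} (h : IsPairing _ ρ) {j : ℕ}
    (h₀ : ρ none = 2 * j + 1) (h₁ : ρ (some (.inl none)) = 2 * j) :
    IsPairing A₁ (fun m => ρ (some (.inr m))) ∧
    IsPairing A₂ (fun m => ρ (some (.inl (some (.inl m))))) ∧
    IsPairing A₃ (fun m => ρ (some (.inl (some (.inr m))))) := by
  have key : ∀ m, ρ m / 2 = j → m = none ∨ m = some (.inl none) := by
    intro m hm
    have : ρ m = 2 * j + 1 ∨ ρ m = 2 * j := by omega
    rcases this with e | e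
    · exact Or.inl (h.injective (e.trans h₀.symm))
    · exact Or.inr (h.injective (e.trans h₁.symm))
  refine ⟨h.restrict _ ?_ (fun _ _ => Iff.rfl) ?_, h.restrict _ ?_ (fun _ _ => Iff.rfl) ?_,
    h.restrict _ ?_ (fun _ _ => Iff.rfl) ?_⟩
  · exact (Option.some_injective _).comp Sum.inr_injective
  · rintro m (_ | ((_ | (m' | m')) | m')) hm hq
    · exact (key _ (hq.symm.trans (by omega))).elim nofun nofun
    · exact (key _ (hq.symm.trans (by omega))).elim nofun nofun
    · exact (hm.elim id id).elim
    · exact (hm.elim id id).elim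
    · exact ⟨m', rfl⟩
  · exact (Option.some_injective _).comp (Sum.inl_injective.comp
      ((Option.some_injective _).comp Sum.inl_injective))
  · rintro m (_ | ((_ | (m' | m')) | m')) hm hq
    · exact (key _ (hq.symm.trans (by omega))).elim nofun nofun
    · exact (key _ (hq.symm.trans (by omega))).elim nofun nofun
    · exact ⟨m', rfl⟩
    · exact (hm.elim id id).elim
    · exact (hm.elim id id).elim
  · exact (Option.some_injective _).comp (Sum.inl_injective.comp
      ((Option.some_injective _).comp Sum.inr_injective))
  · rintro m (_ | ((_ | (m' | m')) | m')) hm hq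
    · exact (key _ (hq.symm.trans (by omega))).elim nofun nofun
    · exact (key _ (hq.symm.trans (by omega))).elim nofun nofun
    · exact (hm.elim id id).elim
    · exact ⟨m', rfl⟩
    · exact (hm.elim id id).elim

/-- A binary tree with a rank function. -/
abbrev RankedTree : Type := Σ A : BinaryTree Unit, Node A → ℕ

namespace RankedTree

/-- The left subtree. -/
def left : RankedTree → RankedTree
  | ⟨.nil, ρ⟩ => ⟨.nil, ρ⟩
  | ⟨.node _ l _, ρ⟩ => ⟨l, fun m => ρ (some (.inl m))⟩

/-- The right subtree. -/
def right : RankedTree → RankedTree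
  | ⟨.nil, ρ⟩ => ⟨.nil, ρ⟩
  | ⟨.node _ _ r, ρ⟩ => ⟨r, fun m => ρ (some (.inr m))⟩

/-- The rank of the root, and `1` for the tree without nodes. -/
def rootRank : RankedTree → ℕ
  | ⟨.nil, _⟩ => 1
  | ⟨.node _ _ _, ρ⟩ => ρ none

end RankedTree

namespace PairTree

/-- The ranked binary tree of a labelled ternary tree. -/
def toRanked (t : PairTree) : RankedTree := ⟨t.toTree, t.rank⟩

/-- The root of a ternary tree carries an odd rank, whereas the lower node of a pair has an even
one. This parity reveals the orientation of a vertex; the value `1` for the empty tree makes leaves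
obey the same rule. -/
theorem odd_rootRank_toRanked : ∀ t : PairTree, t.toRanked.rootRank % 2 = 1
  | leaf => rfl
  | graft true j _ _ _ => show (2 * j + 1) % 2 = 1 by omega
  | graft false j _ _ _ => show (2 * j + 1) % 2 = 1 by omega

theorem toRanked_injective : Function.Injective toRanked := by
  intro t
  induction t with
  | leaf =>
    rintro (_ | ⟨_ | _, j, t₁, t₂, t₃⟩) h
    · rfl
    · cases congrArg Sigma.fst h
    · cases congrArg Sigma.fst h
  | graft b j t₁ t₂ t₃ ih₁ ih₂ ih₃ =>
    rintro (_ | ⟨b', j', t₁', t₂', t₃'⟩) h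
    · cases b <;> cases congrArg Sigma.fst h
    · have hl := congrArg RankedTree.left h
      have hr := congrArg RankedTree.right h
      have h₀ := congrArg RankedTree.rootRank h
      cases b <;> cases b'
      · have e₀ : 2 * j + 1 = 2 * j' + 1 := h₀
        obtain rfl : j = j' := by omega
        rw [ih₁ hr, ih₂ (congrArg RankedTree.left hl), ih₃ (congrArg RankedTree.right hl)]
      · have e : 2 * j = t₁'.toRanked.rootRank := congrArg RankedTree.rootRank hl
        have := odd_rootRank_toRanked t₁'
        omega
      · have e : 2 * j = t₁'.toRanked.rootRank := congrArg RankedTree.rootRank hr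
        have := odd_rootRank_toRanked t₁'
        omega
      · have e₀ : 2 * j + 1 = 2 * j' + 1 := h₀
        obtain rfl : j = j' := by omega
        rw [ih₁ hl, ih₂ (congrArg RankedTree.left hr), ih₃ (congrArg RankedTree.right hr)]

theorem mem_labels_iff {t : PairTree} (ht : t.Decreasing) {i : ℕ} :
    i ∈ t.labels ↔ ∃ m, t.rank m / 2 = i := by
  constructor
  · intro hi
    obtain ⟨m, -, hm, -⟩ := exists_pair (M := ℕ) t ht i hi
    exact ⟨m, by omega⟩
  · rintro ⟨m, rfl⟩
    exact rank_div_two_mem t m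

/-- A common label `i` would yield two different nodes of rank `2i`. -/
theorem disjoint_labels {A : Type*} {ρ : A → ℕ} (hρ : Function.Injective ρ) {t t' : PairTree}
    (ht : t.Decreasing) (ht' : t'.Decreasing) (e : Node t.toTree → A) (e' : Node t'.toTree → A)
    (he : ∀ m, ρ (e m) = t.rank m) (he' : ∀ m, ρ (e' m) = t'.rank m) (hne : ∀ m m', e m ≠ e' m') :
    Disjoint t.labels t'.labels := by
  refine disjoint_left.2 fun i hi hi' => ?_
  obtain ⟨m, -, hm, -⟩ := exists_pair (M := ℕ) t ht i hi
  obtain ⟨m', -, hm', -⟩ := exists_pair (M := ℕ) t' ht' i hi'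
  exact hne m m' (hρ (by rw [he, he', hm, hm']))

end PairTree

open PairTree in
theorem IsPairing.exists_pairTree : ∀ (A : BinaryTree Unit) (ρ : Node A → ℕ), IsPairing A ρ →
    ∃ t : PairTree, t.Decreasing ∧ t.toRanked = ⟨A, ρ⟩
  | .nil, ρ, _ => ⟨.leaf, trivial, by
      rw [toRanked, Sigma.mk.inj_iff]
      exact ⟨rfl, heq_of_eq (funext fun m => nomatch m)⟩⟩
  | .node _ l r, ρ, h => by
    obtain ⟨m, hne, hq, -⟩ := h.partner none
    have hmax := fun m => h.mono m none (Node.le_root m)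
    obtain ⟨j, hj⟩ : ∃ j, j = ρ none / 2 := ⟨_, rfl⟩
    have hm := hmax m
    -- The root has the largest rank, so within its own pair it takes the odd place and its partner
    -- `m` the even one.
    have h₀ : ρ none = 2 * j + 1 := by omega
    have h₁ : ρ m = 2 * j := by omega
    have hlt : ∀ m' : Node (.node () l r), m' ≠ none → ρ m' ≠ 2 * j + 1 :=
      fun m' hm' e => hm' (h.injective (e.trans h₀.symm))
    rcases m with _ | (m | m)
    · exact absurd rfl hne
    · match l, ρ, h, hmax, hlt, m with
      | .node _ A₂ A₃, ρ, h, hmax, hlt, m =>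
        -- The child of the root above `m` has rank at least `2j` and less than `2j+1`. By
        -- injectivity it is `m`: the partner of the root is one of its children.
        have e₁ : ρ (some (.inl none)) = 2 * j := by
          have a₁ := h.mono (some (.inl m)) (some (.inl none)) (Node.le_root m)
          have a₂ := hmax (some (.inl none))
          have a₃ := hlt (some (.inl none)) nofun
          omega
        obtain ⟨p₁, p₂, p₃⟩ := h.of_left h₀ e₁
        obtain ⟨t₁, d₁, q₁⟩ := exists_pairTree _ _ p₁
        obtain ⟨t₂, d₂, q₂⟩ := exists_pairTree _ _ p₂
        obtain ⟨t₃, d₃, q₃⟩ := exists_pairTree _ _ p₃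
        obtain ⟨rfl, q₁⟩ := Sigma.mk.inj_iff.1 q₁
        obtain ⟨rfl, q₂⟩ := Sigma.mk.inj_iff.1 q₂
        obtain ⟨rfl, q₃⟩ := Sigma.mk.inj_iff.1 q₃
        replace q₁ := congrFun (eq_of_heq q₁)
        replace q₂ := congrFun (eq_of_heq q₂)
        replace q₃ := congrFun (eq_of_heq q₃)
        refine ⟨graft false j t₁ t₂ t₃, ⟨⟨d₁, d₂, d₃⟩, ⟨fun i hi => ?_, fun i hi => ?_,
          fun i hi => ?_⟩,
          disjoint_labels h.injective d₁ d₂ _ _ (fun m => (q₁ m).symm) (fun m => (q₂ m).symm)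
            nofun,
          disjoint_labels h.injective d₁ d₃ _ _ (fun m => (q₁ m).symm) (fun m => (q₃ m).symm)
            nofun,
          disjoint_labels h.injective d₂ d₃ _ _ (fun m => (q₂ m).symm) (fun m => (q₃ m).symm)
            nofun⟩, ?_⟩
        · obtain ⟨-, m, -, hm, -⟩ := exists_pair (M := ℕ) t₁ d₁ i hi
          have b₁ := hmax (some (.inr m))
          have b₂ := hlt (some (.inr m)) nofun
          rw [← q₁ m] at *
          omega
        · obtain ⟨-, m, -, hm, -⟩ := exists_pair (M := ℕ) t₂ d₂ i hi
          have b₁ := hmax (some (.inl (some (.inl m))))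
          have b₂ := hlt (some (.inl (some (.inl m)))) nofun
          rw [← q₂ m] at *
          omega
        · obtain ⟨-, m, -, hm, -⟩ := exists_pair (M := ℕ) t₃ d₃ i hi
          have b₁ := hmax (some (.inl (some (.inr m))))
          have b₂ := hlt (some (.inl (some (.inr m)))) nofun
          rw [← q₃ m] at *
          omega
        · refine Sigma.mk.inj_iff.2 ⟨rfl, heq_of_eq (funext fun m => ?_)⟩
          rcases m with _ | ((_ | (m | m)) | m)
          · exact h₀.symm
          · exact e₁.symm
          · exact q₂ m
          · exact q₃ m
          · exact q₁ m
    · match r, ρ, h, hmax, hlt, m with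
      | .node _ A₂ A₃, ρ, h, hmax, hlt, m =>
        have e₁ : ρ (some (.inr none)) = 2 * j := by
          have a₁ := h.mono (some (.inr m)) (some (.inr none)) (Node.le_root m)
          have a₂ := hmax (some (.inr none))
          have a₃ := hlt (some (.inr none)) nofun
          omega
        obtain ⟨p₁, p₂, p₃⟩ := h.of_right h₀ e₁
        obtain ⟨t₁, d₁, q₁⟩ := exists_pairTree _ _ p₁
        obtain ⟨t₂, d₂, q₂⟩ := exists_pairTree _ _ p₂
        obtain ⟨t₃, d₃, q₃⟩ := exists_pairTree _ _ p₃
        obtain ⟨rfl, q₁⟩ := Sigma.mk.inj_iff.1 q₁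
        obtain ⟨rfl, q₂⟩ := Sigma.mk.inj_iff.1 q₂
        obtain ⟨rfl, q₃⟩ := Sigma.mk.inj_iff.1 q₃
        replace q₁ := congrFun (eq_of_heq q₁)
        replace q₂ := congrFun (eq_of_heq q₂)
        replace q₃ := congrFun (eq_of_heq q₃)
        refine ⟨graft true j t₁ t₂ t₃, ⟨⟨d₁, d₂, d₃⟩, ⟨fun i hi => ?_, fun i hi => ?_,
          fun i hi => ?_⟩,
          disjoint_labels h.injective d₁ d₂ _ _ (fun m => (q₁ m).symm) (fun m => (q₂ m).symm)
            nofun,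
          disjoint_labels h.injective d₁ d₃ _ _ (fun m => (q₁ m).symm) (fun m => (q₃ m).symm)
            nofun,
          disjoint_labels h.injective d₂ d₃ _ _ (fun m => (q₂ m).symm) (fun m => (q₃ m).symm)
            nofun⟩, ?_⟩
        · obtain ⟨-, m, -, hm, -⟩ := exists_pair (M := ℕ) t₁ d₁ i hi
          have b₁ := hmax (some (.inl m))
          have b₂ := hlt (some (.inl m)) nofun
          rw [← q₁ m] at *
          omega
        · obtain ⟨-, m, -, hm, -⟩ := exists_pair (M := ℕ) t₂ d₂ i hi
          have b₁ := hmax (some (.inr (some (.inl m))))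
          have b₂ := hlt (some (.inr (some (.inl m)))) nofun
          rw [← q₂ m] at *
          omega
        · obtain ⟨-, m, -, hm, -⟩ := exists_pair (M := ℕ) t₃ d₃ i hi
          have b₁ := hmax (some (.inr (some (.inr m))))
          have b₂ := hlt (some (.inr (some (.inr m)))) nofun
          rw [← q₃ m] at *
          omega
        · refine Sigma.mk.inj_iff.2 ⟨rfl, heq_of_eq (funext fun m => ?_)⟩
          rcases m with _ | (m | (_ | (m | m)))
          · exact h₀.symm
          · exact q₁ m
          · exact e₁.symm
          · exact q₂ m
          · exact q₃ m
termination_by A => sizeOf A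

/-- The ranked tree of an ordered tree. -/
def orderedToRanked {n : ℕ} (p : Σ A : BinaryTree Unit, Fin (2 * n) ≃ Node A) : RankedTree :=
  ⟨p.1, fun m => (p.2.symm m : ℕ)⟩

theorem orderedToRanked_injective {n : ℕ} :
    Function.Injective (orderedToRanked (n := n)) := by
  rintro ⟨A, σ⟩ ⟨A', σ'⟩ h
  obtain ⟨rfl, h⟩ := Sigma.mk.inj_iff.1 h
  have h := congrFun (eq_of_heq h)
  congr 1
  have : σ.symm = σ'.symm := Equiv.ext fun m => Fin.ext (h m)
  simpa using congrArg Equiv.symm this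

theorem exists_pairTree_of_mem_pairedTrees {n : ℕ}
    {p : Σ A : BinaryTree Unit, Fin (2 * n) ≃ Node A} (hp : p ∈ pairedTrees n) :
    ∃ t : PairTree, t.Decreasing ∧ t.labels = range n ∧ t.toRanked = orderedToRanked p := by
  obtain ⟨A, σ⟩ := p
  simp only [pairedTrees, mem_sigma, mem_filter, mem_univ, true_and] at hp
  obtain ⟨-, hmono, hpair⟩ := hp
  have hP : IsPairing A (fun m => (σ.symm m : ℕ)) := by
    refine ⟨Fin.val_injective.comp σ.symm.injective, hmono, fun m => ?_⟩
    obtain ⟨⟨i, hi⟩, rfl⟩ := σ.surjective m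
    obtain ⟨j, rfl | rfl⟩ : ∃ j, i = 2 * j ∨ i = 2 * j + 1 := ⟨i / 2, by omega⟩
    · refine ⟨σ ⟨2 * j + 1, by omega⟩, ?_, ?_, Or.inl (hpair ⟨j, by omega⟩)⟩ <;>
        simp only [Equiv.symm_apply_apply] <;> omega
    · refine ⟨σ ⟨2 * j, by omega⟩, ?_, ?_, Or.inr (hpair ⟨j, by omega⟩)⟩ <;>
        simp only [Equiv.symm_apply_apply] <;> omega
  obtain ⟨t, ht, h⟩ := hP.exists_pairTree
  refine ⟨t, ht, ?_, h⟩
  obtain ⟨rfl, h⟩ := Sigma.mk.inj_iff.1 h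
  have h := congrFun (eq_of_heq h)
  ext i
  rw [PairTree.mem_labels_iff ht, mem_range]
  constructor
  · rintro ⟨m, rfl⟩
    rw [h]
    have := (σ.symm m).2
    omega
  · intro hi
    refine ⟨σ ⟨2 * i, by omega⟩, ?_⟩
    rw [h]
    simp

/-- With labels `0, …, n-1` the rank is an injection of the `2n` nodes into `Fin (2 * n)`, hence a
bijection, whose inverse is the required enumeration. -/
theorem exists_mem_pairedTrees {n : ℕ} {t : PairTree} (ht : t.Decreasing)
    (hl : t.labels = range n) : ∃ p ∈ pairedTrees n, orderedToRanked p = t.toRanked := by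
  have hlt : ∀ m, t.rank m < 2 * n := fun m => by
    have := t.rank_div_two_mem m
    rw [hl, mem_range] at this
    omega
  have hinj : Function.Injective fun m => (⟨t.rank m, hlt m⟩ : Fin (2 * n)) :=
    fun m m' h => t.rank_injective ht (congrArg Fin.val h)
  have hnum : t.toTree.numNodes = 2 * n := by rw [t.card_labels ht, hl, card_range]
  have hbij := (Fintype.bijective_iff_injective_and_card _).2
    ⟨hinj, by rw [card_node, hnum, Fintype.card_fin]⟩
  refine ⟨⟨t.toTree, (Equiv.ofBijective _ hbij).symm⟩, ?_, rfl⟩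
  simp only [pairedTrees, mem_sigma, mem_filter, mem_univ, true_and]
  refine ⟨BinaryTree.mem_treesOfNumNodesEq.2 hnum, fun m j h => t.rank_mono ht m j h,
    fun j => ?_⟩
  obtain ⟨m, m', hm, hm', hle, -⟩ := t.exists_pair (M := ℕ) ht j (by rw [hl]; simp)
  have e : (Equiv.ofBijective _ hbij).symm ⟨2 * j, by omega⟩ = m := by
    rw [Equiv.symm_apply_eq]; exact Fin.ext hm.symm
  have e' : (Equiv.ofBijective _ hbij).symm ⟨2 * j + 1, by omega⟩ = m' := by
    rw [Equiv.symm_apply_eq]; exact Fin.ext hm'.symm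
  rw [e, e']
  exact hle

/-! ### Enumeration of the decreasing trees by their label sets. -/

namespace PairTree

open Classical in
/-- The decreasing trees with the set of labels `S`, provided that `S` lies below `n`. -/
noncomputable def withLabels : ℕ → Finset ℕ → Finset PairTree
  | 0, _ => {leaf}
  | n + 1, S => if n ∈ S then
      ((S.erase n).powerset.sigma fun S₁ => (S.erase n \ S₁).powerset.sigma fun S₂ =>
        (univ : Finset Bool) ×ˢ withLabels n S₁ ×ˢ withLabels n S₂ ×ˢ
          withLabels n ((S.erase n \ S₁) \ S₂)).image
        fun x => graft x.2.2.1 n x.2.2.2.1 x.2.2.2.2.1 x.2.2.2.2.2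
    else withLabels n S

/-- Labels decrease away from the root, so if `n` is present in `S ⊆ range (n + 1)` it must be the
root label; the rest of `S` is partitioned among the three subtrees. -/
theorem mem_withLabels : ∀ (n : ℕ) (S : Finset ℕ), S ⊆ range n → ∀ t : PairTree,
    t ∈ withLabels n S ↔ t.Decreasing ∧ t.labels = S
  | 0, S, hS, t => by
    obtain rfl : S = ∅ := by simpa using hS
    rw [withLabels, mem_singleton]
    constructor
    · rintro rfl
      exact ⟨trivial, rfl⟩
    · rintro ⟨-, h⟩
      cases t with
      | leaf => rfl
      | graft b j t₁ t₂ t₃ => simp [labels] at h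
  | n + 1, S, hS, t => by
    have hS' : S.erase n ⊆ range n := fun i hi => by
      have := mem_range.1 (hS (mem_of_mem_erase hi))
      have := ne_of_mem_erase hi
      exact mem_range.2 (by omega)
    rw [withLabels]
    split_ifs with hn
    · simp only [mem_image, mem_sigma, mem_product, mem_univ, true_and, mem_powerset,
        Sigma.exists, Prod.exists]
      constructor
      · rintro ⟨S₁, S₂, b, t₁, t₂, t₃, ⟨h₁, h₂, m₁, m₂, m₃⟩, rfl⟩
        have s₂ := h₂.trans sdiff_subset
        have s₃ : (S.erase n \ S₁) \ S₂ ⊆ S.erase n := sdiff_subset.trans sdiff_subset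
        obtain ⟨d₁, rfl⟩ := (mem_withLabels n _ (h₁.trans hS') _).1 m₁
        obtain ⟨d₂, rfl⟩ := (mem_withLabels n _ (s₂.trans hS') _).1 m₂
        obtain ⟨d₃, e₃⟩ := (mem_withLabels n _ (s₃.trans hS') _).1 m₃
        have h₁₂ : Disjoint t₁.labels t₂.labels :=
          disjoint_left.2 fun i hi hi' => (mem_sdiff.1 (h₂ hi')).2 hi
        refine ⟨⟨⟨d₁, d₂, d₃⟩, ⟨fun i hi => mem_range.1 (hS' (h₁ hi)),
          fun i hi => mem_range.1 (hS' (s₂ hi)), fun i hi => mem_range.1 (hS' (s₃ (e₃ ▸ hi)))⟩,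
          h₁₂, ?_, ?_⟩, ?_⟩
        · rw [e₃]
          exact disjoint_left.2 fun i hi hi' => (mem_sdiff.1 (mem_sdiff.1 hi').1).2 hi
        · rw [e₃]
          exact disjoint_left.2 fun i hi hi' => (mem_sdiff.1 hi').2 hi
        · rw [labels, e₃, sdiff_sdiff_left, sup_eq_union, union_sdiff_of_subset
            (union_subset h₁ s₂), insert_erase hn]
      · rintro ⟨hd, hl⟩
        cases t with
        | leaf => rw [← hl] at hn; simp [labels] at hn
        | graft b j t₁ t₂ t₃ =>
          obtain ⟨⟨d₁, d₂, d₃⟩, ⟨l₁, l₂, l₃⟩, h₁₂, h₁₃, h₂₃⟩ := hd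
          obtain rfl : j = n := by
            have hj : j ∈ S := by rw [← hl, labels]; exact mem_insert_self _ _
            have hj' := mem_range.1 (hS hj)
            rw [← hl] at hn
            simp only [labels, mem_insert, mem_union] at hn
            rcases hn with h | (h | h) | h
            · exact h.symm
            · have := l₁ _ h; omega
            · have := l₂ _ h; omega
            · have := l₃ _ h; omega
          have he : S.erase j = t₁.labels ∪ t₂.labels ∪ t₃.labels := by
            rw [← hl, labels, erase_insert]
            simp only [mem_union]
            rintro ((hi | hi) | hi)
            · exact lt_irrefl _ (l₁ _ hi)
            · exact lt_irrefl _ (l₂ _ hi)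
            · exact lt_irrefl _ (l₃ _ hi)
          have e₃ : (S.erase j \ t₁.labels) \ t₂.labels = t₃.labels := by
            rw [he, sdiff_sdiff_left, sup_eq_union, union_sdiff_cancel_left]
            exact disjoint_union_left.2 ⟨h₁₃, h₂₃⟩
          have s₁ : t₁.labels ⊆ S.erase j := by
            rw [he]; exact fun i hi => by simp [hi]
          have s₂ : t₂.labels ⊆ S.erase j \ t₁.labels := fun i hi =>
            mem_sdiff.2 ⟨by rw [he]; simp [hi], disjoint_right.1 h₁₂ hi⟩
          refine ⟨t₁.labels, t₂.labels, b, t₁, t₂, t₃, ⟨s₁, s₂, ?_, ?_, ?_⟩, rfl⟩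
          · exact (mem_withLabels j _ (s₁.trans hS') _).2 ⟨d₁, rfl⟩
          · exact (mem_withLabels j _ ((s₂.trans sdiff_subset).trans hS') _).2 ⟨d₂, rfl⟩
          · exact (mem_withLabels j _ ((sdiff_subset.trans sdiff_subset).trans hS') _).2
              ⟨d₃, e₃.symm⟩
    · rw [erase_eq_of_notMem hn] at hS'
      exact mem_withLabels n S hS' t

/-- No tree is counted twice: `S₁` and `S₂` are recovered as the label sets of `t₁` and `t₂`. -/
theorem sum_withLabels_succ {M : Type*} [AddCommMonoid M] (n : ℕ) (S : Finset ℕ)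
    (hS : S ⊆ range (n + 1)) (hn : n ∈ S) (f : PairTree → M) :
    ∑ t ∈ withLabels (n + 1) S, f t =
      ∑ S₁ ∈ (S.erase n).powerset, ∑ S₂ ∈ (S.erase n \ S₁).powerset, ∑ b : Bool,
        ∑ t₁ ∈ withLabels n S₁, ∑ t₂ ∈ withLabels n S₂,
          ∑ t₃ ∈ withLabels n ((S.erase n \ S₁) \ S₂), f (graft b n t₁ t₂ t₃) := by
  have hS' : S.erase n ⊆ range n := fun i hi => by
    have := mem_range.1 (hS (mem_of_mem_erase hi))
    have := ne_of_mem_erase hi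
    exact mem_range.2 (by omega)
  classical
  rw [withLabels, if_pos hn, sum_image]
  · simp only [sum_sigma, sum_product]
  · rintro ⟨S₁, S₂, b, t₁, t₂, t₃⟩ h ⟨S₁', S₂', b', t₁', t₂', t₃'⟩ h' heq
    simp only [coe_sigma, Set.mem_sigma_iff, mem_coe, mem_product, mem_powerset] at h h'
    simp only [graft.injEq] at heq
    obtain ⟨rfl, -, rfl, rfl, rfl⟩ := heq
    obtain ⟨h₁, h₂, -, m₁, m₂, -⟩ := h
    obtain ⟨h₁', h₂', -, m₁', m₂', -⟩ := h'
    obtain rfl := ((mem_withLabels n _ (h₁.trans hS') _).1 m₁).2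
    obtain rfl := ((mem_withLabels n _ ((h₂.trans sdiff_subset).trans hS') _).1 m₂).2
    obtain rfl := ((mem_withLabels n _ (h₁'.trans hS') _).1 m₁').2
    obtain rfl := ((mem_withLabels n _ ((h₂'.trans sdiff_subset).trans hS') _).1 m₂').2
    rfl

theorem sum_pairedTrees {M : Type*} [AddCommMonoid M] (n : ℕ) (f : RankedTree → M) :
    ∑ p ∈ pairedTrees n, f (orderedToRanked p) =
      ∑ t ∈ withLabels n (range n), f t.toRanked := by
  choose t h₁ h₂ h₃ using @exists_pairTree_of_mem_pairedTrees n
  refine sum_bij (fun p hp => t hp) (fun p hp => ?_) (fun p hp p' hp' h => ?_) (fun s hs => ?_)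
    (fun p hp => ?_)
  · exact (mem_withLabels n _ subset_rfl _).2 ⟨h₁ hp, h₂ hp⟩
  · exact orderedToRanked_injective ((h₃ hp).symm.trans ((congrArg toRanked h).trans (h₃ hp')))
  · obtain ⟨hd, hl⟩ := (mem_withLabels n _ subset_rfl _).1 hs
    obtain ⟨p, hp, e⟩ := exists_mem_pairedTrees hd hl
    exact ⟨p, hp, toRanked_injective ((h₃ hp).trans e)⟩
  · rw [h₃ hp]

end PairTree

/-! ### The coefficient recursion on ternary trees. -/

theorem rankedCoeff_right (w : ℝ → ℝ → ℝ) (L : ℝ) (a : ℝ → ℝ) {A₁ A₂ A₃ : BinaryTree Unit}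
    (ρ : Node (.node () A₁ (.node () A₂ A₃)) → ℕ)
    (h : ∀ m, ρ (some (.inl m)) < ρ (some (.inr none))) :
    rankedCoeff w L a _ ρ = coeffStep w L a
      (rankedCoeff w L a A₁ fun m => ρ (some (.inl m)))
      (rankedCoeff w L a A₂ fun m => ρ (some (.inr (some (.inl m)))))
      (rankedCoeff w L a A₃ fun m => ρ (some (.inr (some (.inr m))))) := by
  cases A₁ with
  | nil => rfl
  | node u l r => exact if_pos (h none)

theorem rankedCoeff_left (w : ℝ → ℝ → ℝ) (L : ℝ) (a : ℝ → ℝ) {A₁ A₂ A₃ : BinaryTree Unit}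
    (ρ : Node (.node () (.node () A₂ A₃) A₁) → ℕ)
    (h : ∀ m, ρ (some (.inr m)) < ρ (some (.inl none))) :
    rankedCoeff w L a _ ρ = coeffStep w L a
      (rankedCoeff w L a A₁ fun m => ρ (some (.inr m)))
      (rankedCoeff w L a A₂ fun m => ρ (some (.inl (some (.inl m)))))
      (rankedCoeff w L a A₃ fun m => ρ (some (.inl (some (.inr m))))) := by
  cases A₁ with
  | nil => rfl
  | node u l r => exact if_neg (h none).not_gt

namespace PairTree

/-- The coefficient of a labelled ternary tree with kernel `w`. -/
noncomputable def coeff (w : ℝ → ℝ → ℝ) (L : ℝ) (a : ℝ → ℝ) : PairTree → ℝ → ℝ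
  | leaf => fun _ => 1
  | graft _ _ t₁ t₂ t₃ =>
    coeffStep w L a (t₁.coeff w L a) (t₂.coeff w L a) (t₃.coeff w L a)

theorem rankedCoeff_toRanked (w : ℝ → ℝ → ℝ) (L : ℝ) (a : ℝ → ℝ) : ∀ t : PairTree,
    t.Decreasing → rankedCoeff w L a t.toRanked.1 t.toRanked.2 = t.coeff w L a
  | leaf, _ => rfl
  | graft true j t₁ t₂ t₃, ⟨⟨d₁, d₂, d₃⟩, ⟨l₁, _⟩, _⟩ => by
    rw [coeff, ← rankedCoeff_toRanked w L a t₁ d₁, ← rankedCoeff_toRanked w L a t₂ d₂,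
      ← rankedCoeff_toRanked w L a t₃ d₃]
    refine rankedCoeff_right w L a _ fun m => ?_
    have := l₁ _ (t₁.rank_div_two_mem m)
    show t₁.rank m < 2 * j
    omega
  | graft false j t₁ t₂ t₃, ⟨⟨d₁, d₂, d₃⟩, ⟨l₁, _⟩, _⟩ => by
    rw [coeff, ← rankedCoeff_toRanked w L a t₁ d₁, ← rankedCoeff_toRanked w L a t₂ d₂,
      ← rankedCoeff_toRanked w L a t₃ d₃]
    refine rankedCoeff_left w L a _ fun m => ?_
    have := l₁ _ (t₁.rank_div_two_mem m)
    show t₁.rank m < 2 * j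
    omega

theorem sum_treeCoeff (w : ℝ → ℝ → ℝ) (L : ℝ) (a : ℝ → ℝ) (n : ℕ) (ξ : ℝ) :
    ∑ p ∈ pairedTrees n, treeCoeff w L a p ξ =
      ∑ t ∈ withLabels n (range n), t.coeff w L a ξ := by
  refine (sum_pairedTrees n fun q => rankedCoeff w L a q.1 q.2 ξ).trans (sum_congr rfl ?_)
  intro t ht
  rw [rankedCoeff_toRanked w L a t ((mem_withLabels n _ subset_rfl _).1 ht).1]

end PairTree

/-! ### Convergence of the recursion and summation over all trees. -/

theorem neg_freq (L : ℝ) (k : NZ) :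
    -(((k : ℤ) : ℝ) / L) = (((⟨-k, neg_ne_zero.2 k.2⟩ : NZ) : ℤ) : ℝ) / L := by
  push_cast
  ring

/-- A function of the frequency that is bounded on the lattice `{k / L : k ≠ 0}`. -/
def BoundedOnLattice (L : ℝ) (V : ℝ → ℝ) : Prop :=
  ∃ M, 0 ≤ M ∧ ∀ k : NZ, |V ((k : ℤ) / L)| ≤ M

/-- A kernel that is bounded on the lattice. -/
def BoundedKernel (L : ℝ) (w : ℝ → ℝ → ℝ) : Prop :=
  ∃ M, 0 ≤ M ∧ ∀ k j : NZ, |w ((k : ℤ) / L) ((j : ℤ) / L)| ≤ M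

section

variable {L : ℝ} {a : ℝ → ℝ} {w : ℝ → ℝ → ℝ}

theorem exists_coeffStep_bound (hw : BoundedKernel L w) {V₁ V₂ V₃ : ℝ → ℝ}
    (h₁ : BoundedOnLattice L V₁) (h₂ : BoundedOnLattice L V₂) (h₃ : BoundedOnLattice L V₃) :
    ∃ M, 0 ≤ M ∧ ∀ k j : NZ, |w ((k : ℤ) / L) ((j : ℤ) / L) * V₁ ((j : ℤ) / L) *
      (V₂ (-((j : ℤ) / L)) * V₃ ((k : ℤ) / L) + V₃ (-((j : ℤ) / L)) * V₂ ((k : ℤ) / L)) *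
      ‖fourierAt L a ((j : ℤ) / L)‖ ^ 2| ≤ M * ‖fourierAt L a ((j : ℤ) / L)‖ ^ 2 := by
  obtain ⟨B, hB, hw⟩ := hw
  obtain ⟨M₁, hM₁, h₁⟩ := h₁
  obtain ⟨M₂, hM₂, h₂⟩ := h₂
  obtain ⟨M₃, hM₃, h₃⟩ := h₃
  refine ⟨B * M₁ * (M₂ * M₃ + M₃ * M₂), by positivity, fun k j => ?_⟩
  rw [abs_mul, abs_mul, abs_mul, abs_of_nonneg (sq_nonneg ‖fourierAt L a ((j : ℤ) / L)‖)]
  have n₂ := h₂ ⟨-j, neg_ne_zero.2 j.2⟩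
  have n₃ := h₃ ⟨-j, neg_ne_zero.2 j.2⟩
  rw [← neg_freq] at n₂ n₃
  gcongr
  · exact hw k j
  · exact h₁ j
  · refine (abs_add_le _ _).trans ?_
    rw [abs_mul, abs_mul]
    gcongr
    · exact h₃ k
    · exact h₂ k

variable (hb : Summable fun j : NZ => ‖fourierAt L a ((j : ℤ) / L)‖ ^ 2)

include hb in
theorem summable_coeffStep (hw : BoundedKernel L w) {V₁ V₂ V₃ : ℝ → ℝ}
    (h₁ : BoundedOnLattice L V₁) (h₂ : BoundedOnLattice L V₂) (h₃ : BoundedOnLattice L V₃)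
    (k : NZ) :
    Summable fun j : NZ => w ((k : ℤ) / L) ((j : ℤ) / L) * V₁ ((j : ℤ) / L) *
      (V₂ (-((j : ℤ) / L)) * V₃ ((k : ℤ) / L) + V₃ (-((j : ℤ) / L)) * V₂ ((k : ℤ) / L)) *
      ‖fourierAt L a ((j : ℤ) / L)‖ ^ 2 := by
  obtain ⟨M, -, h⟩ := exists_coeffStep_bound (a := a) hw h₁ h₂ h₃
  exact Summable.of_norm_bounded (hb.mul_left M) fun j => h k j

include hb in
theorem hasSum_coeffStep (hw : BoundedKernel L w) {V₁ V₂ V₃ : ℝ → ℝ}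
    (h₁ : BoundedOnLattice L V₁) (h₂ : BoundedOnLattice L V₂) (h₃ : BoundedOnLattice L V₃)
    (k : NZ) :
    HasSum (fun j : NZ => 1 / (2 * Real.pi * L) *
      (w ((k : ℤ) / L) ((j : ℤ) / L) * V₁ ((j : ℤ) / L) *
      (V₂ (-((j : ℤ) / L)) * V₃ ((k : ℤ) / L) + V₃ (-((j : ℤ) / L)) * V₂ ((k : ℤ) / L)) *
      ‖fourierAt L a ((j : ℤ) / L)‖ ^ 2)) (coeffStep w L a V₁ V₂ V₃ ((k : ℤ) / L)) :=
  (summable_coeffStep hb hw h₁ h₂ h₃ k).hasSum.mul_left _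

include hb in
theorem boundedOnLattice_coeffStep (hw : BoundedKernel L w) {V₁ V₂ V₃ : ℝ → ℝ}
    (h₁ : BoundedOnLattice L V₁) (h₂ : BoundedOnLattice L V₂) (h₃ : BoundedOnLattice L V₃) :
    BoundedOnLattice L (coeffStep w L a V₁ V₂ V₃) := by
  obtain ⟨M, hM, h⟩ := exists_coeffStep_bound (a := a) hw h₁ h₂ h₃
  refine ⟨|1 / (2 * Real.pi * L)| * (M * ∑' j : NZ, ‖fourierAt L a ((j : ℤ) / L)‖ ^ 2),
    by positivity, fun k => ?_⟩
  rw [coeffStep, abs_mul]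
  gcongr
  rw [← tsum_mul_left]
  exact tsum_of_norm_bounded (f := fun j : NZ => w ((k : ℤ) / L) ((j : ℤ) / L) *
      V₁ ((j : ℤ) / L) *
      (V₂ (-((j : ℤ) / L)) * V₃ ((k : ℤ) / L) + V₃ (-((j : ℤ) / L)) * V₂ ((k : ℤ) / L)) *
      ‖fourierAt L a ((j : ℤ) / L)‖ ^ 2) (hb.mul_left M).hasSum fun j => h k j

include hb in
theorem PairTree.boundedOnLattice_coeff (hw : BoundedKernel L w) :
    ∀ t : PairTree, BoundedOnLattice L (t.coeff w L a)
  | .leaf => ⟨1, zero_le_one, fun _ => by simp [PairTree.coeff]⟩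
  | .graft _ _ t₁ t₂ t₃ => boundedOnLattice_coeffStep hb hw (t₁.boundedOnLattice_coeff hw)
      (t₂.boundedOnLattice_coeff hw) (t₃.boundedOnLattice_coeff hw)

/-- The multinomial theorem as two nested binomial expansions; the two summands differ by exchanging
`y` and `z`, so each gives the same power. -/
theorem sum_powerset_pow (s : Finset ℕ) (x y z : ℝ) :
    ∑ S₁ ∈ s.powerset, x ^ #S₁ * ∑ S₂ ∈ (s \ S₁).powerset,
      (y ^ #S₂ * z ^ #((s \ S₁) \ S₂) + y ^ #((s \ S₁) \ S₂) * z ^ #S₂) =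
    2 * (x + (y + z)) ^ #s := by
  rw [← sum_pow_mul_eq_add_pow, mul_sum]
  refine sum_congr rfl fun S₁ hS₁ => ?_
  rw [sum_add_distrib]
  have e : ∀ y z : ℝ, ∑ S₂ ∈ (s \ S₁).powerset, y ^ #S₂ * z ^ #((s \ S₁) \ S₂) =
      (y + z) ^ (#s - #S₁) := fun y z => by
    rw [← card_sdiff_of_subset (mem_powerset.1 hS₁), ← sum_pow_mul_eq_add_pow]
    exact sum_congr rfl fun S₂ hS₂ => by rw [card_sdiff_of_subset (mem_powerset.1 hS₂)]
  have e' : ∑ S₂ ∈ (s \ S₁).powerset, y ^ #((s \ S₁) \ S₂) * z ^ #S₂ =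
      (y + z) ^ (#s - #S₁) := by
    rw [add_comm y z, ← e z y]
    exact sum_congr rfl fun _ _ => mul_comm _ _
  rw [e, e']
  ring

/-- The coefficient does not see the orientation, hence the factor `2`. It turns `1/(2πL)`, together
with the `2` of `sum_powerset_pow`, into the prefactor `2/(πL)` of `U`. -/
theorem sum_bool_sum_sum_sum {ι : Type*} (s₁ s₂ s₃ : Finset ι) (f₁ f₂ f₃ g₂ g₃ : ι → ℝ)
    (c w b : ℝ) :
    ∑ _b : Bool, ∑ t₁ ∈ s₁, ∑ t₂ ∈ s₂, ∑ t₃ ∈ s₃,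
      c * (w * f₁ t₁ * (f₂ t₂ * g₃ t₃ + f₃ t₃ * g₂ t₂) * b) =
    2 * (c * (w * (∑ t₁ ∈ s₁, f₁ t₁) * ((∑ t₂ ∈ s₂, f₂ t₂) * (∑ t₃ ∈ s₃, g₃ t₃) +
      (∑ t₃ ∈ s₃, f₃ t₃) * ∑ t₂ ∈ s₂, g₂ t₂) * b)) := by
  simp only [sum_const, card_univ, Fintype.card_bool, nsmul_eq_mul, Nat.cast_ofNat,
    ← mul_sum, ← sum_mul, sum_add_distrib]

-- Induction on the bound `n` for the labels, at all frequencies simultaneously, because the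
-- subtrees are evaluated at `η`, `-η` and `ξ`. Working with arbitrary label sets `S` is what allows
-- the labels to be distributed.
include hb in
theorem PairTree.sum_coeff (hw : BoundedKernel L w) {W : ℝ → ℝ}
    (hW : ∀ k : NZ, HasSum (fun j : NZ => 2 / (Real.pi * L) *
      (‖fourierAt L a ((j : ℤ) / L)‖ ^ 2 * w ((k : ℤ) / L) ((j : ℤ) / L))) (W ((k : ℤ) / L)))
    (hodd : ∀ k : NZ, W (-((k : ℤ) / L)) = -W ((k : ℤ) / L)) :
    ∀ (n : ℕ) (S : Finset ℕ), S ⊆ range n → ∀ k : NZ,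
      ∑ t ∈ withLabels n S, t.coeff w L a ((k : ℤ) / L) = W ((k : ℤ) / L) ^ #S
  | 0, S, hS, k => by
    obtain rfl : S = ∅ := by simpa using hS
    simp [withLabels, coeff]
  | n + 1, S, hS, k => by
    have hS' : S.erase n ⊆ range n := fun i hi => by
      have := mem_range.1 (hS (mem_of_mem_erase hi))
      have := ne_of_mem_erase hi
      exact mem_range.2 (by omega)
    by_cases hn : n ∈ S
    · rw [sum_withLabels_succ n S hS hn]
      -- Only finitely many trees occur, so their series over `η` are added term by term; it remains
      -- to identify the summand for each `η`.
      have key := hasSum_sum (s := (S.erase n).powerset) fun S₁ _ =>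
        hasSum_sum (s := (S.erase n \ S₁).powerset) fun S₂ _ =>
        hasSum_sum (s := (univ : Finset Bool)) fun b _ =>
        hasSum_sum (s := withLabels n S₁) fun t₁ _ =>
        hasSum_sum (s := withLabels n S₂) fun t₂ _ =>
        hasSum_sum (s := withLabels n ((S.erase n \ S₁) \ S₂)) fun t₃ _ =>
          hasSum_coeffStep hb hw (t₁.boundedOnLattice_coeff hb hw)
            (t₂.boundedOnLattice_coeff hb hw) (t₃.boundedOnLattice_coeff hb hw) k
      refine key.unique ?_
      have hpow : W ((k : ℤ) / L) ^ #S = W ((k : ℤ) / L) * W ((k : ℤ) / L) ^ #(S.erase n) := by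
        rw [card_erase_of_mem hn, ← pow_succ', Nat.sub_add_cancel (card_pos.2 ⟨n, hn⟩)]
      rw [hpow]
      refine Eq.mpr (congrArg (fun f => HasSum f _) (funext fun j => ?_))
        ((hW k).mul_right (W ((k : ℤ) / L) ^ #(S.erase n)))
      have expand : ∀ S₁ ∈ (S.erase n).powerset, ∀ S₂ ∈ (S.erase n \ S₁).powerset,
          (∑ _b : Bool, ∑ t₁ ∈ withLabels n S₁, ∑ t₂ ∈ withLabels n S₂,
            ∑ t₃ ∈ withLabels n ((S.erase n \ S₁) \ S₂), 1 / (2 * Real.pi * L) *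
            (w ((k : ℤ) / L) ((j : ℤ) / L) * t₁.coeff w L a ((j : ℤ) / L) *
            (t₂.coeff w L a (-((j : ℤ) / L)) * t₃.coeff w L a ((k : ℤ) / L) +
              t₃.coeff w L a (-((j : ℤ) / L)) * t₂.coeff w L a ((k : ℤ) / L)) *
            ‖fourierAt L a ((j : ℤ) / L)‖ ^ 2)) =
          (1 / (Real.pi * L) * (‖fourierAt L a ((j : ℤ) / L)‖ ^ 2 *
            w ((k : ℤ) / L) ((j : ℤ) / L))) *
          (W ((j : ℤ) / L) ^ #S₁ * ((-W ((j : ℤ) / L)) ^ #S₂ *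
            W ((k : ℤ) / L) ^ #((S.erase n \ S₁) \ S₂) +
            (-W ((j : ℤ) / L)) ^ #((S.erase n \ S₁) \ S₂) * W ((k : ℤ) / L) ^ #S₂)) := by
        intro S₁ hS₁ S₂ hS₂
        have s₁ := (mem_powerset.1 hS₁).trans hS'
        have s₂ := ((mem_powerset.1 hS₂).trans sdiff_subset).trans hS'
        have s₃ : (S.erase n \ S₁) \ S₂ ⊆ range n :=
          (sdiff_subset.trans sdiff_subset).trans hS'
        have i₁ := sum_coeff hw hW hodd n S₁ s₁ j
        have i₂ := sum_coeff hw hW hodd n S₂ s₂ k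
        have i₃ := sum_coeff hw hW hodd n _ s₃ k
        have i₂' := sum_coeff hw hW hodd n S₂ s₂ ⟨-j, neg_ne_zero.2 j.2⟩
        have i₃' := sum_coeff hw hW hodd n _ s₃ ⟨-j, neg_ne_zero.2 j.2⟩
        rw [← neg_freq, hodd] at i₂' i₃'
        rw [← i₁, ← i₂, ← i₃, ← i₂', ← i₃']
        rw [sum_bool_sum_sum_sum]
        ring
      rw [sum_congr rfl fun S₁ hS₁ => sum_congr rfl fun S₂ hS₂ => expand S₁ hS₁ S₂ hS₂]
      simp only [← mul_sum]
      -- The cancellation behind the closed form: `W(η) + (-W(η) + W(ξ)) = W(ξ)`.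
      rw [sum_powerset_pow, add_neg_cancel_left]
      ring
    · rw [erase_eq_of_notMem hn] at hS'
      rw [withLabels, if_neg hn]
      exact sum_coeff hw hW hodd n S hS' k

end

theorem hasSum_of_eq {ι E : Type*} [AddCommMonoid E] [TopologicalSpace E] {f g : ι → E} {a b : E}
    (h : HasSum f a) (hfg : ∀ i, g i = f i) (hab : b = a) : HasSum g b := by
  rwa [funext hfg, hab]

/-! ### Fourier coefficients and Parseval's identity. -/

section Fourier

variable {L : ℝ} {a : ℝ → ℝ}

theorem fourierAt_eq_fourierCoeffOn (hL : 0 < L) (j : ℤ) :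
    fourierAt L a (j / L) = (Real.sqrt (2 * Real.pi * L) : ℝ) *
      fourierCoeffOn (show (0 : ℝ) < 2 * Real.pi * L by positivity) (fun x => (a x : ℂ)) j := by
  have hT : (0 : ℝ) < 2 * Real.pi * L := by positivity
  rw [fourierCoeffOn_eq_integral, fourierAt, sub_zero, Complex.real_smul, ← mul_assoc,
    ← Complex.ofReal_mul]
  congr 1
  · have h := Real.mul_self_sqrt hT.le
    have h0 : Real.sqrt (2 * Real.pi * L) ≠ 0 := (Real.sqrt_pos.2 hT).ne'
    congr 1
    rw [← h, Real.sqrt_mul_self (Real.sqrt_nonneg _)]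
    field_simp
  · refine intervalIntegral.integral_congr fun x _ => ?_
    simp only [smul_eq_mul]
    rw [mul_comm, fourier_coe_apply]
    congr 2
    have hL' : (L : ℂ) ≠ 0 := by exact_mod_cast hL.ne'
    have hpi : (Real.pi : ℂ) ≠ 0 := by exact_mod_cast Real.pi_ne_zero
    push_cast
    field_simp

theorem hasSum_norm_fourierAt_sq (hL : 0 < L) (ha : MeasureTheory.MemLp a 2
    (MeasureTheory.volume.restrict (Set.Ioc 0 (2 * Real.pi * L)))) :
    HasSum (fun j : ℤ => ‖fourierAt L a (j / L)‖ ^ 2)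
      (∫ x in (0 : ℝ)..(2 * Real.pi * L), a x ^ 2) := by
  have hT : (0 : ℝ) < 2 * Real.pi * L := by positivity
  have h := (hasSum_sq_fourierCoeffOn hT (f := fun x => (a x : ℂ)) ha.ofReal).mul_left
    (2 * Real.pi * L)
  rw [sub_zero, smul_eq_mul, mul_inv_cancel_left₀ hT.ne'] at h
  simp only [Complex.norm_real, Real.norm_eq_abs, sq_abs] at h
  refine hasSum_of_eq h (fun j => ?_) rfl
  rw [fourierAt_eq_fourierCoeffOn hL, norm_mul, mul_pow, Complex.norm_real, Real.norm_eq_abs,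
    sq_abs, Real.sq_sqrt hT.le]

theorem fourierAt_neg (ξ : ℝ) :
    fourierAt L a (-ξ) = (starRingEnd ℂ) (fourierAt L a ξ) := by
  rw [fourierAt, fourierAt, map_mul, Complex.conj_ofReal, ← intervalIntegral.intervalIntegral_conj]
  congr 1
  refine intervalIntegral.integral_congr fun x _ => ?_
  simp only [map_mul, Complex.conj_ofReal, ← Complex.exp_conj, map_neg, Complex.conj_I]
  push_cast
  ring_nf

theorem norm_fourierAt_neg (ξ : ℝ) : ‖fourierAt L a (-ξ)‖ = ‖fourierAt L a ξ‖ := by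
  rw [fourierAt_neg, RCLike.norm_conj]

theorem fourierAt_mul_neg (ξ : ℝ) :
    fourierAt L a ξ * fourierAt L a (-ξ) = ((‖fourierAt L a ξ‖ ^ 2 : ℝ) : ℂ) := by
  rw [fourierAt_neg, Complex.mul_conj, Complex.normSq_eq_norm_sq]

end Fourier

/-! ### The kernels and the functions `U` and `Uexact`. -/

theorem F_eq (ξ η : ℝ) : F ξ η = (1 + η ^ 2) / (η * (3 + η ^ 2 + ξ ^ 2 - ξ * η)) := by
  have h : 1 + η ^ 2 ≠ 0 := by positivity
  rw [F, omega, show 3 + (η ^ 2 + ξ ^ 2 + (ξ - η) ^ 2) / 2 = 3 + η ^ 2 + ξ ^ 2 - ξ * η by ring,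
    div_mul_eq_mul_div, one_div_div]

theorem Ftilde_eq (ξ η : ℝ) : Ftilde ξ η =
    ξ * (1 + η ^ 2) / ((3 + η ^ 2 + ξ ^ 2 - ξ * η) * (3 + η ^ 2 + ξ ^ 2 + ξ * η)) := by
  rw [Ftilde, show 3 + (η ^ 2 + ξ ^ 2 + (ξ - η) ^ 2) / 2 = 3 + η ^ 2 + ξ ^ 2 - ξ * η by ring,
    show 3 + (η ^ 2 + ξ ^ 2 + (ξ + η) ^ 2) / 2 = 3 + η ^ 2 + ξ ^ 2 + ξ * η by ring]

theorem resonance_pos (ξ η : ℝ) : 0 < 3 + η ^ 2 + ξ ^ 2 - ξ * η := by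
  nlinarith [sq_nonneg (ξ - η), sq_nonneg ξ, sq_nonneg η]

theorem resonance_pos' (ξ η : ℝ) : 0 < 3 + η ^ 2 + ξ ^ 2 + ξ * η := by
  nlinarith [sq_nonneg (ξ + η), sq_nonneg ξ, sq_nonneg η]

theorem F_add_F_neg (ξ : ℝ) {η : ℝ} (hη : η ≠ 0) : F ξ η + F ξ (-η) = 2 * Ftilde ξ η := by
  have h := (resonance_pos ξ η).ne'
  have h' := (resonance_pos' ξ η).ne'
  have e : 3 + (-η) ^ 2 + ξ ^ 2 - ξ * -η = 3 + η ^ 2 + ξ ^ 2 + ξ * η := by ring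
  rw [F_eq, F_eq, Ftilde_eq, e, div_add_div _ _ (mul_ne_zero hη h)
    (mul_ne_zero (neg_ne_zero.2 hη) h'), mul_div_assoc', div_eq_div_iff
    (mul_ne_zero (mul_ne_zero hη h) (mul_ne_zero (neg_ne_zero.2 hη) h')) (mul_ne_zero h h')]
  ring

theorem Ftilde_neg_left (ξ η : ℝ) : Ftilde (-ξ) η = -Ftilde ξ η := by
  rw [Ftilde_eq, Ftilde_eq]
  rw [show 3 + η ^ 2 + (-ξ) ^ 2 - -ξ * η = 3 + η ^ 2 + ξ ^ 2 + ξ * η by ring,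
    show 3 + η ^ 2 + (-ξ) ^ 2 + -ξ * η = 3 + η ^ 2 + ξ ^ 2 - ξ * η by ring, mul_comm (_ + _)]
  ring

/-- One factor of the denominator dominates `(1+ξ²)/2` and the other `(1+η²)/2`, while the numerator
times `⟨ξ⟩` is at most `(1+ξ²)(1+η²)`. -/
theorem sqrt_mul_abs_Ftilde_le (ξ η : ℝ) : Real.sqrt (1 + ξ ^ 2) * |Ftilde ξ η| ≤ 4 := by
  have h := resonance_pos ξ η
  have h' := resonance_pos' ξ η
  have hs : Real.sqrt (1 + ξ ^ 2) * |ξ| ≤ 1 + ξ ^ 2 := by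
    have h1 : |ξ| ≤ Real.sqrt (1 + ξ ^ 2) := Real.abs_le_sqrt (by linarith)
    calc Real.sqrt (1 + ξ ^ 2) * |ξ| ≤ Real.sqrt (1 + ξ ^ 2) * Real.sqrt (1 + ξ ^ 2) := by gcongr
      _ = 1 + ξ ^ 2 := Real.mul_self_sqrt (by positivity)
  rw [Ftilde_eq, abs_div, abs_mul, abs_of_pos (mul_pos h h'), abs_of_nonneg (a := 1 + η ^ 2)
    (by positivity), ← mul_div_assoc, div_le_iff₀ (mul_pos h h'), ← mul_assoc]
  have h1 : (1 + ξ ^ 2) / 2 ≤ 3 + η ^ 2 + ξ ^ 2 - ξ * η := by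
    nlinarith [sq_nonneg (ξ - η), sq_nonneg η]
  have h2 : (1 + η ^ 2) / 2 ≤ 3 + η ^ 2 + ξ ^ 2 + ξ * η := by
    nlinarith [sq_nonneg (ξ + η), sq_nonneg ξ]
  calc Real.sqrt (1 + ξ ^ 2) * |ξ| * (1 + η ^ 2) ≤ (1 + ξ ^ 2) * (1 + η ^ 2) := by gcongr
    _ = 4 * ((1 + ξ ^ 2) / 2 * ((1 + η ^ 2) / 2)) := by ring
    _ ≤ _ := by gcongr

/-- On the lattice `|η| ≥ 1/L`, so this bounds `F` by `2L`. That suffices for convergence; estimates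
uniform in `L` come from `Ftilde`. -/
theorem abs_F_le (ξ η : ℝ) : |F ξ η| ≤ 2 * |η|⁻¹ := by
  have h := resonance_pos ξ η
  have h1 : 1 + η ^ 2 ≤ 2 * (3 + η ^ 2 + ξ ^ 2 - ξ * η) := by
    nlinarith [sq_nonneg (ξ - η), sq_nonneg ξ]
  rw [F_eq, abs_div, abs_mul, abs_of_pos h, abs_of_nonneg (a := 1 + η ^ 2) (by positivity),
    mul_comm |η|, ← div_div, div_eq_mul_inv _ |η|]
  gcongr
  rwa [div_le_iff₀ h]

theorem abs_Fexact_le (ξ η : ℝ) : |Fexact ξ η| ≤ |F ξ η| := by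
  rw [Fexact, abs_mul]
  refine mul_le_of_le_one_left (abs_nonneg _) ?_
  split_ifs <;> norm_num [abs_of_pos]

section Lattice

variable {L : ℝ}

theorem abs_inv_freq_le (hL : 0 < L) (j : NZ) : |((j : ℤ) : ℝ) / L|⁻¹ ≤ L := by
  have h : (1 : ℝ) ≤ |((j : ℤ) : ℝ)| := by exact_mod_cast Int.one_le_abs j.2
  rw [abs_div, abs_of_pos hL, inv_div, div_le_iff₀ (by linarith)]
  nlinarith

theorem boundedKernel_F (hL : 0 < L) : BoundedKernel L F :=
  ⟨2 * L, by positivity, fun k j => (abs_F_le _ _).trans (by gcongr; exact abs_inv_freq_le hL j)⟩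

theorem boundedKernel_Fexact (hL : 0 < L) : BoundedKernel L Fexact :=
  ⟨2 * L, by positivity, fun k j => (abs_Fexact_le _ _).trans
    ((abs_F_le _ _).trans (by gcongr; exact abs_inv_freq_le hL j))⟩

variable {a : ℝ → ℝ}

theorem summable_nz_of_hasSum {f : ℤ → ℝ} {c : ℝ} (hf : HasSum f c) (h : ∀ j, 0 ≤ f j) :
    Summable (fun j : NZ => f j) ∧ ∑' j : NZ, f j ≤ c :=
  ⟨hf.summable.subtype _, (hf.summable.tsum_subtype_le f _ h).trans_eq hf.tsum_eq⟩

variable (hL : 0 < L) (hb : Summable fun j : NZ => ‖fourierAt L a ((j : ℤ) / L)‖ ^ 2)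

include hb in
theorem summable_Ftilde (ξ : ℝ) :
    Summable fun j : NZ => ‖fourierAt L a ((j : ℤ) / L)‖ ^ 2 * Ftilde ξ ((j : ℤ) / L) := by
  refine Summable.of_norm_bounded (hb.mul_right 4) fun j => ?_
  rw [norm_mul, Real.norm_eq_abs, Real.norm_eq_abs, abs_of_nonneg (sq_nonneg _)]
  gcongr
  refine le_trans (le_mul_of_one_le_left (abs_nonneg _) ?_) (sqrt_mul_abs_Ftilde_le ξ _)
  exact Real.one_le_sqrt.2 (by nlinarith [sq_nonneg ξ])

include hb in
theorem hasSum_U_Ftilde (ξ : ℝ) : HasSum (fun j : NZ => 2 / (Real.pi * L) *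
    (‖fourierAt L a ((j : ℤ) / L)‖ ^ 2 * Ftilde ξ ((j : ℤ) / L))) (U L a ξ) :=
  (summable_Ftilde hb ξ).hasSum.mul_left _

include hL hb in
theorem hasSum_U_F (ξ : ℝ) : HasSum (fun j : NZ => 2 / (Real.pi * L) *
    (‖fourierAt L a ((j : ℤ) / L)‖ ^ 2 * F ξ ((j : ℤ) / L))) (U L a ξ) := by
  have hs : Summable fun j : NZ => ‖fourierAt L a ((j : ℤ) / L)‖ ^ 2 * F ξ ((j : ℤ) / L) := by
    refine Summable.of_norm_bounded (hb.mul_right (2 * L)) fun j => ?_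
    rw [norm_mul, Real.norm_eq_abs, Real.norm_eq_abs, abs_of_nonneg (sq_nonneg _)]
    gcongr
    refine (abs_F_le ξ _).trans ?_
    gcongr
    exact abs_inv_freq_le hL j
  have h := hs.hasSum
  -- Since `|â|` is even, averaging the series with its image under `η ↦ -η` replaces `F` by its
  -- even part in `η`, which is `Ftilde`.
  let e : NZ ≃ NZ := ⟨fun j => ⟨-j, neg_ne_zero.2 j.2⟩, fun j => ⟨-j, neg_ne_zero.2 j.2⟩,
    fun j => by simp, fun j => by simp⟩
  have h' := e.hasSum_iff.2 h
  have hsum := (h.add h').mul_left (1 / 2)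
  have heq : (fun j : NZ => ‖fourierAt L a ((j : ℤ) / L)‖ ^ 2 * Ftilde ξ ((j : ℤ) / L)) =
      fun j : NZ => 1 / 2 * (‖fourierAt L a ((j : ℤ) / L)‖ ^ 2 * F ξ ((j : ℤ) / L) +
        ((fun j : NZ => ‖fourierAt L a ((j : ℤ) / L)‖ ^ 2 * F ξ ((j : ℤ) / L)) ∘ e) j) := by
    funext j
    have hj : ((j : ℤ) : ℝ) / L ≠ 0 := div_ne_zero (Int.cast_ne_zero.2 j.2) hL.ne'
    have hF := F_add_F_neg ξ hj
    have he : (((e j : NZ) : ℤ) : ℝ) / L = -(((j : ℤ) : ℝ) / L) := (neg_freq L j).symm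
    rw [Function.comp_apply, he, norm_fourierAt_neg]
    linear_combination (-1 / 2 * ‖fourierAt L a ((j : ℤ) / L)‖ ^ 2) * hF
  rw [← heq] at hsum
  rw [U, hsum.tsum_eq]
  refine hasSum_of_eq (h.mul_left (2 / (Real.pi * L))) (fun _ => rfl) ?_
  ring

theorem U_neg (ξ : ℝ) : U L a (-ξ) = -U L a ξ := by
  simp only [U, Ftilde_neg_left, mul_neg, tsum_neg]

theorem Uexact_neg (ξ : ℝ) : Uexact L a (-ξ) = -Uexact L a ξ := by
  rw [Uexact, Uexact, U_neg, norm_fourierAt_neg, neg_sq]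
  rw [show 3 * Real.pi * L * -ξ * (3 + ξ ^ 2) = -(3 * Real.pi * L * ξ * (3 + ξ ^ 2)) by ring,
    div_neg]
  ring

-- The series differs from that of `F` in two terms: `F(ξ,ξ) = (1+ξ²)/(ξ(3+ξ²))` is dropped and
-- `F(ξ,-ξ) = -1/(3ξ)` is halved. The loss `F(ξ,ξ) + F(ξ,-ξ)/2` equals `(3+5ξ²)/(6ξ(3+ξ²))`.
include hL hb in
theorem hasSum_Uexact (k : NZ) : HasSum (fun j : NZ => 2 / (Real.pi * L) *
    (‖fourierAt L a ((j : ℤ) / L)‖ ^ 2 * Fexact ((k : ℤ) / L) ((j : ℤ) / L)))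
    (Uexact L a ((k : ℤ) / L)) := by
  classical
  set ξ : ℝ := ((k : ℤ) : ℝ) / L with hξ
  have hξ0 : ξ ≠ 0 := div_ne_zero (Int.cast_ne_zero.2 k.2) hL.ne'
  let k' : NZ := ⟨-k, neg_ne_zero.2 k.2⟩
  have hk' : ((k' : ℤ) : ℝ) / L = -ξ := (neg_freq L k).symm
  have inj : ∀ j i : NZ, ((j : ℤ) : ℝ) / L = ((i : ℤ) : ℝ) / L ↔ j = i := fun j i => by
    rw [div_left_inj' hL.ne', Int.cast_inj, Subtype.ext_iff]
  have h1 := hasSum_ite_eq k (2 / (Real.pi * L) * (‖fourierAt L a ξ‖ ^ 2 * F ξ ξ))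
  have h2 := hasSum_ite_eq k' (2 / (Real.pi * L) * (‖fourierAt L a ξ‖ ^ 2 * (F ξ (-ξ) / 2)))
  have hne : ξ ≠ -ξ := fun h => hξ0 (by linarith)
  refine hasSum_of_eq (((hasSum_U_F hL hb ξ).sub h1).sub h2) (fun j => ?_) ?_
  · by_cases e1 : j = k
    · have e2 : k ≠ k' := fun h => hne (by rw [← hk', ← h])
      rw [e1, if_pos rfl, if_neg e2, Fexact, if_pos hξ.symm, ← hξ]
      ring
    · have n1 : ((j : ℤ) : ℝ) / L ≠ ξ := fun h => e1 ((inj j k).1 h)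
      rw [if_neg e1, Fexact, if_neg n1]
      by_cases e2 : j = k'
      · rw [e2, hk', if_pos rfl, if_pos rfl, norm_fourierAt_neg]
        ring
      · have n2 : ((j : ℤ) : ℝ) / L ≠ -ξ := fun h => e2 ((inj j k').1 (h.trans hk'.symm))
        rw [if_neg e2, if_neg n2]
        ring
  · rw [Uexact, F_eq, F_eq]
    have hp := (resonance_pos ξ ξ).ne'
    have hp' := (resonance_pos' ξ ξ).ne'
    rw [show ξ * (3 + ξ ^ 2 + ξ ^ 2 - ξ * ξ) = ξ * (3 + ξ ^ 2) by ring,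
      show -ξ * (3 + (-ξ) ^ 2 + ξ ^ 2 - ξ * -ξ) = -(3 * ξ * (1 + ξ ^ 2)) by ring, neg_sq]
    have q1 : 3 + ξ ^ 2 ≠ 0 := by positivity
    have q2 : 1 + ξ ^ 2 ≠ 0 := by positivity
    have hpi := Real.pi_ne_zero
    have hL0 := hL.ne'
    field_simp
    ring

include hL hb in
theorem sqrt_mul_abs_U_le {N : ℝ} (hN : ∑' j : NZ, ‖fourierAt L a ((j : ℤ) / L)‖ ^ 2 ≤ N)
    (ξ : ℝ) : Real.sqrt (1 + ξ ^ 2) * |U L a ξ| ≤ 8 / Real.pi * N / L := by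
  have hpi := Real.pi_pos
  have h : |Real.sqrt (1 + ξ ^ 2) *
      ∑' j : NZ, ‖fourierAt L a ((j : ℤ) / L)‖ ^ 2 * Ftilde ξ ((j : ℤ) / L)| ≤ N * 4 := by
    rw [← tsum_mul_left]
    refine (tsum_of_norm_bounded (f := fun j : NZ => Real.sqrt (1 + ξ ^ 2) *
      (‖fourierAt L a ((j : ℤ) / L)‖ ^ 2 * Ftilde ξ ((j : ℤ) / L)))
      (hb.mul_right 4).hasSum fun j => ?_).trans ?_
    · rw [norm_mul, norm_mul, Real.norm_eq_abs, Real.norm_eq_abs, Real.norm_eq_abs,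
        abs_of_nonneg (Real.sqrt_nonneg _), abs_of_nonneg (sq_nonneg _), mul_left_comm]
      gcongr
      exact sqrt_mul_abs_Ftilde_le ξ _
    · rw [tsum_mul_right]
      gcongr
  rw [abs_mul, abs_of_nonneg (Real.sqrt_nonneg _)] at h
  rw [U, abs_mul, abs_of_pos (by positivity : 0 < 2 / (Real.pi * L)), mul_left_comm]
  calc 2 / (Real.pi * L) * _ ≤ 2 / (Real.pi * L) * (N * 4) := by gcongr
    _ = 8 / Real.pi * N / L := by field_simp; ring

-- With `π > 3`, `U` contributes at most `8/3`. The diagonal term contributes at most `5`, because a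
-- single `|â(ξ)|²` is bounded by the whole sum and `3+5ξ² ≤ 5(3+ξ²)`.
include hL hb in
theorem abs_mul_abs_Uexact_le {N : ℝ}
    (hN : ∑' j : NZ, ‖fourierAt L a ((j : ℤ) / L)‖ ^ 2 ≤ N) (k : NZ) :
    |((k : ℤ) : ℝ) / L| * |Uexact L a ((k : ℤ) / L)| ≤ 10 * N / L := by
  have hU := sqrt_mul_abs_U_le hL hb hN ((k : ℤ) / L)
  have hk : ‖fourierAt L a ((k : ℤ) / L)‖ ^ 2 ≤ N :=
    (hb.le_tsum k fun _ _ => sq_nonneg _).trans hN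
  have hN0 : 0 ≤ N := (sq_nonneg _).trans hk
  have hξ0 : ((k : ℤ) : ℝ) / L ≠ 0 := div_ne_zero (Int.cast_ne_zero.2 k.2) hL.ne'
  generalize ((k : ℤ) : ℝ) / L = ξ at *
  have hpi := Real.pi_gt_three
  have hpi0 := Real.pi_pos
  have h1 : |ξ| * |U L a ξ| ≤ 8 / 3 * N / L := by
    refine (mul_le_mul_of_nonneg_right (Real.abs_le_sqrt (by linarith)) (abs_nonneg _)).trans
      (hU.trans ?_)
    gcongr
  have h2 : |ξ| * |‖fourierAt L a ξ‖ ^ 2 * (3 + 5 * ξ ^ 2) /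
      (3 * Real.pi * L * ξ * (3 + ξ ^ 2))| ≤ 5 * N / L := by
    rw [← abs_mul]
    have e : ξ * (‖fourierAt L a ξ‖ ^ 2 * (3 + 5 * ξ ^ 2) /
        (3 * Real.pi * L * ξ * (3 + ξ ^ 2))) =
        ‖fourierAt L a ξ‖ ^ 2 * (3 + 5 * ξ ^ 2) / (3 * Real.pi * L * (3 + ξ ^ 2)) := by
      have q1 : 3 + ξ ^ 2 ≠ 0 := by positivity
      field_simp
    rw [e, abs_of_nonneg (by positivity), div_le_div_iff₀ (by positivity) hL]
    calc ‖fourierAt L a ξ‖ ^ 2 * (3 + 5 * ξ ^ 2) * L ≤ N * (5 * (3 + ξ ^ 2)) * L := by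
          gcongr
          linarith
      _ = 5 * N * (1 * L * (3 + ξ ^ 2)) := by ring
      _ ≤ 5 * N * (3 * Real.pi * L * (3 + ξ ^ 2)) := by gcongr; linarith
  calc |ξ| * |Uexact L a ξ| ≤ |ξ| * (|U L a ξ| + _) := by
        rw [Uexact]; gcongr; exact abs_sub _ _
    _ ≤ 8 / 3 * N / L + 5 * N / L := by rw [mul_add]; exact add_le_add h1 h2
    _ ≤ 10 * N / L := by
      rw [← add_div]
      gcongr
      linarith

end Lattice

/-! ### Resonances. -/

theorem omega_zero : omega 0 = 0 := by simp [omega]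

theorem omega_neg (x : ℝ) : omega (-x) = -omega x := by simp [omega, neg_div]

theorem omega_ne_zero {x : ℝ} (hx : x ≠ 0) : omega x ≠ 0 :=
  div_ne_zero hx (by positivity)

theorem Delta_comm (x y z : ℝ) : Delta x y z = Delta x z y := by
  rw [Delta, Delta]; ring

/-- The numerator of `Δ` factors as `-ξη(ξ-η)(3+η²+ξ²-ξη)`. The product form remains valid at `η =
ξ` and `ξ = 0`, where `Δ` vanishes. -/
theorem Delta_mul_F (ξ : ℝ) {η : ℝ} (hη : η ≠ 0) :
    Delta ξ η (ξ - η) * F ξ η = -(omega ξ * omega (ξ - η)) := by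
  have h := (resonance_pos ξ η).ne'
  have h1 : 1 + ξ ^ 2 ≠ 0 := by positivity
  have h2 : 1 + η ^ 2 ≠ 0 := by positivity
  have h3 : 1 + (ξ - η) ^ 2 ≠ 0 := by positivity
  have hD : Delta ξ η (ξ - η) = -(ξ * η * (ξ - η) * (3 + η ^ 2 + ξ ^ 2 - ξ * η)) /
      ((1 + ξ ^ 2) * (1 + η ^ 2) * (1 + (ξ - η) ^ 2)) := by
    rw [Delta, omega, omega, omega, div_sub_div _ _ h1 h2, div_sub_div _ _ (by positivity) h3]
    congr 1
    ring
  rw [hD, F_eq, omega, omega]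
  field_simp

/-- The factor of a tree term that belongs to a pair of nodes. The three frequencies are those of
the other child of the upper node and of the two children of the lower node. -/
noncomputable def pairFactor (ξ₁ ξ₂ ξ₃ : ℝ) : ℂ :=
  (omega (ξ₁ + (ξ₂ + ξ₃)) * omega (ξ₂ + ξ₃) : ℂ) / (Complex.I * Delta (ξ₂ + ξ₃) ξ₂ ξ₃) *
    (if Delta (ξ₂ + ξ₃) ξ₂ ξ₃ + Delta (ξ₁ + (ξ₂ + ξ₃)) ξ₁ (ξ₂ + ξ₃) = 0 then 1 else 0)

theorem pairFactor_eq_F {ξ ξ₁ ξ₂ ξ₃ : ℝ} (h : ξ₁ + (ξ₂ + ξ₃) = ξ) (hξ : ξ ≠ 0) (h₁ : ξ₁ ≠ 0)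
    (h₂₃ : ξ₂ + ξ₃ ≠ 0)
    (hres : Delta (ξ₂ + ξ₃) ξ₂ ξ₃ + Delta (ξ₁ + (ξ₂ + ξ₃)) ξ₁ (ξ₂ + ξ₃) = 0) :
    pairFactor ξ₁ ξ₂ ξ₃ = -Complex.I * F ξ ξ₁ := by
  rw [pairFactor, if_pos hres, h]
  rw [h] at hres
  have hx : ξ₂ + ξ₃ = ξ - ξ₁ := by linarith
  have hm := Delta_mul_F ξ h₁
  rw [← hx] at hm
  have hD : Delta (ξ₂ + ξ₃) ξ₂ ξ₃ = -Delta ξ ξ₁ (ξ₂ + ξ₃) := by linarith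
  have hne : Delta ξ ξ₁ (ξ₂ + ξ₃) ≠ 0 := by
    intro h0
    rw [h0, zero_mul, eq_comm, neg_eq_zero] at hm
    exact mul_ne_zero (omega_ne_zero hξ) (omega_ne_zero h₂₃) hm
  have hne' : (Delta ξ ξ₁ (ξ₂ + ξ₃) : ℂ) ≠ 0 := by exact_mod_cast hne
  have hm' : (Delta ξ ξ₁ (ξ₂ + ξ₃) : ℂ) * F ξ ξ₁ = -(omega ξ * omega (ξ₂ + ξ₃)) := by
    exact_mod_cast hm
  rw [hD, mul_one, div_eq_iff (mul_ne_zero Complex.I_ne_zero (by exact_mod_cast neg_ne_zero.2 hne))]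
  push_cast
  linear_combination hm' - (Delta ξ ξ₁ (ξ₂ + ξ₃) * F ξ ξ₁ : ℂ) * Complex.I_sq

theorem quadratic_coeff_eq_zero {x : ℝ}
    (hx : ∀ p : Polynomial ℚ, p ≠ 0 → p.natDegree ≤ 2 → Polynomial.aeval x p ≠ 0)
    {c₂ c₁ c₀ : ℤ} (h : c₂ * x ^ 2 + c₁ * x + c₀ = 0) : c₂ = 0 := by
  by_contra hc
  have hp : (Polynomial.C (c₂ : ℚ) * Polynomial.X ^ 2 + Polynomial.C (c₁ : ℚ) * Polynomial.X +
      Polynomial.C (c₀ : ℚ)).natDegree = 2 :=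
    Polynomial.natDegree_quadratic (Int.cast_ne_zero.2 hc)
  refine hx _ (fun h0 => ?_) hp.le ?_
  · rw [h0, Polynomial.natDegree_zero] at hp
    norm_num at hp
  · simpa using h

section

variable {L : ℝ} (hL : 0 < L)
  (hq : ∀ p : Polynomial ℚ, p ≠ 0 → p.natDegree ≤ 2 → Polynomial.aeval (L ^ 2) p ≠ 0)

-- A common factor `L` cancels from the four values of `ω`. In the remaining numerator the cubic
-- term in `L²` drops out because the frequency at the upper node is the sum of the other three. The
-- quadratic coefficient is `Σ kᵢ³ - (Σ kᵢ)³`, which factors into the pairwise sums.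
include hL hq in
theorem eq_neg_of_resonant {k₁ k₂ k₃ : ℤ} (h₂₃ : k₂ + k₃ ≠ 0)
    (h : Delta ((k₂ : ℝ) / L + k₃ / L) (k₂ / L) (k₃ / L) +
      Delta ((k₁ : ℝ) / L + (k₂ / L + k₃ / L)) (k₁ / L) (k₂ / L + k₃ / L) = 0) :
    k₂ = -k₁ ∨ k₃ = -k₁ := by
  have hω : ∀ k : ℤ, omega ((k : ℝ) / L) = L * (k / (L ^ 2 + k ^ 2)) := fun k => by
    have h1 : L ^ 2 + (k : ℝ) ^ 2 ≠ 0 := by positivity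
    have h2 : 1 + ((k : ℝ) / L) ^ 2 ≠ 0 := by positivity
    rw [omega]
    field_simp
  have hsum : ((k₁ + k₂ + k₃ : ℤ) : ℝ) / L = (k₁ : ℝ) / L + (k₂ / L + k₃ / L) := by
    push_cast; ring
  rw [← hsum] at h
  simp only [Delta] at h
  have h' : omega (((k₁ + k₂ + k₃ : ℤ) : ℝ) / L) - omega (k₁ / L) - omega (k₂ / L) -
      omega (k₃ / L) = 0 := by linarith
  rw [hω, hω, hω, hω] at h'
  have e₀ : L ^ 2 + ((k₁ + k₂ + k₃ : ℤ) : ℝ) ^ 2 ≠ 0 := by positivity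
  have e₁ : L ^ 2 + (k₁ : ℝ) ^ 2 ≠ 0 := by positivity
  have e₂ : L ^ 2 + (k₂ : ℝ) ^ 2 ≠ 0 := by positivity
  have e₃ : L ^ 2 + (k₃ : ℝ) ^ 2 ≠ 0 := by positivity
  rw [← mul_sub, ← mul_sub, ← mul_sub, mul_eq_zero, or_iff_right hL.ne',
    div_sub_div _ _ e₀ e₁, div_sub_div _ _ (mul_ne_zero e₀ e₁) e₂,
    div_sub_div _ _ (mul_ne_zero (mul_ne_zero e₀ e₁) e₂) e₃, div_eq_zero_iff,
    or_iff_left (mul_ne_zero (mul_ne_zero (mul_ne_zero e₀ e₁) e₂) e₃)] at h'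
  have hz := quadratic_coeff_eq_zero hq (c₂ := -3 * (k₁ + k₂) * (k₁ + k₃) * (k₂ + k₃))
    (c₁ := (k₁ + k₂ + k₃) * (k₁ ^ 2 * k₂ ^ 2 + k₁ ^ 2 * k₃ ^ 2 + k₂ ^ 2 * k₃ ^ 2) -
      k₁ * ((k₁ + k₂ + k₃) ^ 2 * (k₂ ^ 2 + k₃ ^ 2) + k₂ ^ 2 * k₃ ^ 2) -
      k₂ * ((k₁ + k₂ + k₃) ^ 2 * (k₁ ^ 2 + k₃ ^ 2) + k₁ ^ 2 * k₃ ^ 2) -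
      k₃ * ((k₁ + k₂ + k₃) ^ 2 * (k₁ ^ 2 + k₂ ^ 2) + k₁ ^ 2 * k₂ ^ 2))
    (c₀ := (k₁ + k₂ + k₃) * (k₁ ^ 2 * k₂ ^ 2 * k₃ ^ 2) -
      (k₁ + k₂ + k₃) ^ 2 * (k₁ * k₂ ^ 2 * k₃ ^ 2 + k₂ * k₁ ^ 2 * k₃ ^ 2 + k₃ * k₁ ^ 2 * k₂ ^ 2))
    (by
      push_cast at h' ⊢
      linear_combination h')
  have hz' : (k₁ + k₂) * (k₁ + k₃) = 0 := by
    have : (k₁ + k₂) * (k₁ + k₃) * (k₂ + k₃) = 0 := by linarith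
    exact (mul_eq_zero.1 this).resolve_right h₂₃
  rcases mul_eq_zero.1 hz' with h | h
  · left; omega
  · right; omega

theorem resonant_of_eq_neg {ξ₁ ξ₂ ξ₃ : ℝ} (h : ξ₂ = -ξ₁ ∨ ξ₃ = -ξ₁) :
    Delta (ξ₂ + ξ₃) ξ₂ ξ₃ + Delta (ξ₁ + (ξ₂ + ξ₃)) ξ₁ (ξ₂ + ξ₃) = 0 := by
  rcases h with rfl | rfl
  · rw [show ξ₁ + (-ξ₁ + ξ₃) = ξ₃ by ring, Delta, Delta, omega_neg]
    ring
  · rw [show ξ₁ + (ξ₂ + -ξ₁) = ξ₂ by ring, Delta, Delta, omega_neg]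
    ring

-- The two products of indicators are the two pairings of the children of the lower node with `-ξ₁`
-- and `ξ`. Both sides are compared on and off the constraint `k₁ + k₂ + k₃ = k`, so that no
-- constraint is left in the later summation.
include hL hq in
theorem ite_pairFactor {k k₁ k₂ k₃ : ℤ} (hk : k ≠ 0) (h₁ : k₁ ≠ 0) :
    (if k₁ + (k₂ + k₃) = k then pairFactor (k₁ / L) (k₂ / L) (k₃ / L) else 0) =
      -Complex.I * Fexact (k / L) (k₁ / L) *
        ((if k₂ = -k₁ then 1 else 0) * (if k₃ = k then 1 else 0) +
          (if k₂ = k then 1 else 0) * (if k₃ = -k₁ then 1 else 0)) := by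
  have hdiv : ∀ i j : ℤ, (i : ℝ) / L = j / L ↔ i = j := fun i j => by
    rw [div_left_inj' hL.ne', Int.cast_inj]
  have hneg : ∀ j : ℤ, -((j : ℝ) / L) = ((-j : ℤ) : ℝ) / L := fun j => by push_cast; ring
  simp only [Fexact, hneg, hdiv]
  by_cases hs : k₁ + (k₂ + k₃) = k
  · have hs' : (k₁ : ℝ) / L + (k₂ / L + k₃ / L) = k / L := by rw [← hs]; push_cast; ring
    rw [if_pos hs]
    by_cases h₂₃ : k₂ + k₃ = 0
    · have : (k₂ : ℝ) / L + k₃ / L = 0 := by rw [← add_div, ← Int.cast_add, h₂₃]; simp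
      -- The lower node has frequency zero: `ω(0) = 0` kills the left side, and `Fexact` vanishes at
      -- `η = ξ`.
      rw [pairFactor, this, omega_zero, if_pos (show k₁ = k by omega)]
      simp
    · by_cases hres : k₂ = -k₁ ∨ k₃ = -k₁
      · have e := pairFactor_eq_F hs' (div_ne_zero (Int.cast_ne_zero.2 hk) hL.ne')
          (div_ne_zero (Int.cast_ne_zero.2 h₁) hL.ne')
          (by rw [← add_div, ← Int.cast_add]; exact div_ne_zero (Int.cast_ne_zero.2 h₂₃) hL.ne')
          (resonant_of_eq_neg (by rwa [hneg, hdiv, hdiv]))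
        rw [e, if_neg (show k₁ ≠ k by omega)]
        by_cases hd : k₁ = -k
        -- At `η = -ξ` both pairings hold for the same `(k₂, k₃)`, and the weight `1/2` undoes the
        -- double count.
        · rw [if_pos hd, if_pos (show k₂ = -k₁ by omega), if_pos (show k₃ = k by omega),
            if_pos (show k₂ = k by omega), if_pos (show k₃ = -k₁ by omega)]
          push_cast
          ring
        · rw [if_neg hd]
          rcases hres with hr | hr
          · rw [if_pos hr, if_pos (show k₃ = k by omega), if_neg (show ¬ k₂ = k by omega)]
            push_cast
            ring
          · rw [if_pos hr, if_pos (show k₂ = k by omega), if_neg (show ¬ k₂ = -k₁ by omega)]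
            push_cast
            ring
      · have hn : ¬ (Delta ((k₂ : ℝ) / L + k₃ / L) (k₂ / L) (k₃ / L) +
            Delta ((k₁ : ℝ) / L + (k₂ / L + k₃ / L)) (k₁ / L) (k₂ / L + k₃ / L) = 0) :=
          fun h => hres (eq_neg_of_resonant hL hq h₂₃ h)
        rw [pairFactor, if_neg hn, if_neg fun h => hres (Or.inl h),
          if_neg fun h => hres (Or.inr h)]
        simp
  · rw [if_neg hs]
    by_cases hr : k₂ = -k₁
    · rw [if_pos hr, if_neg (show ¬ k₃ = k by omega)]
      by_cases hr' : k₂ = k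
      · rw [if_pos hr', if_neg (show ¬ k₃ = -k₁ by omega)]; simp
      · rw [if_neg hr']; simp
    · rw [if_neg hr]
      by_cases hr' : k₂ = k
      · rw [if_pos hr', if_neg (show ¬ k₃ = -k₁ by omega)]; simp
      · rw [if_neg hr']; simp

end

/-! ### Sums over the fibres of the total frequency. -/

theorem hasSum_mul_prod {Y Z : Type*} {g : Y → ℂ} {h : Z → ℂ} {b c : ℂ} (hg : HasSum g b)
    (hh : HasSum h c) : HasSum (fun p : Y × Z => g p.1 * h p.2) (b * c) := by
  have hs : Summable fun p : Y × Z => g p.1 * h p.2 :=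
    summable_mul_of_summable_norm hg.summable.norm hh.summable.norm
  exact HasSum.mul hg hh hs

/-- The family `f`, summed over the fibres of `s`, converges to `G`, absolutely and with a bound
that is a multiple of `β`. -/
structure FibreSum {X : Type*} (β : ℤ → ℂ) (s : X → ℤ) (f : X → ℂ) (G : ℤ → ℂ) : Prop where
  hasSum : ∀ k, HasSum (fun x => if s x = k then f x else 0) (G k)
  bound : ∃ M : ℝ≥0∞, M ≠ ∞ ∧ ∀ k, ∑' x, ‖if s x = k then f x else 0‖ₑ ≤ M * ‖β k‖ₑ

/-- Sorting the points `x` by the value of `s`, the fibre over `k` contributes at most `M‖β k‖ · ‖β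
k‖`. This is where square summability enters. -/
theorem FibreSum.tsum_enorm_mul_le {X : Type*} {β : ℤ → ℂ} {s : X → ℤ} {f : X → ℂ} {M : ℝ≥0∞}
    (hM : ∀ k, ∑' x, ‖if s x = k then f x else 0‖ₑ ≤ M * ‖β k‖ₑ) :
    ∑' x, ‖f x‖ₑ * ‖β (s x)‖ₑ ≤ M * ∑' k, ‖β k‖ₑ ^ 2 := by
  have h : ∀ x, ‖f x‖ₑ * ‖β (s x)‖ₑ = ∑' k, ‖if s x = k then f x else 0‖ₑ * ‖β k‖ₑ := by
    intro x
    rw [tsum_eq_single (s x)]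
    · rw [if_pos rfl]
    · intro k hk
      rw [if_neg hk.symm]
      simp
  simp_rw [h]
  rw [ENNReal.tsum_comm, ← ENNReal.tsum_mul_left]
  refine ENNReal.tsum_le_tsum fun k => ?_
  rw [ENNReal.tsum_mul_right, sq, ← mul_assoc]
  gcongr
  exact hM k

section

variable {X Y Z : Type*} {β : ℤ → ℂ} {s : X → ℤ} {u : Y → ℤ} {v : Z → ℤ}
  {f : X → ℂ} {g : Y → ℂ} {h : Z → ℂ} {Gf Gg Gh : ℤ → ℂ} {w : ℤ → ℤ → ℂ}

/-- The contribution of the pairing `u = -s`, `v = k` to a product of three families. -/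
def pairingTerm (w : ℤ → ℤ → ℂ) (s : X → ℤ) (u : Y → ℤ) (v : Z → ℤ) (f : X → ℂ) (g : Y → ℂ)
    (h : Z → ℂ) (k : ℤ) (p : X × Y × Z) : ℂ :=
  w k (s p.1) * f p.1 * ((if u p.2.1 = -s p.1 then g p.2.1 else 0) *
    (if v p.2.2 = k then h p.2.2 else 0))

/-- For fixed `x` the other two sums are bounded by multiples of `‖β (s x)‖` and `‖β k‖`. The first
is absorbed by the sum over `x`, and the second is the factor needed to continue the induction. -/
theorem exists_tsum_enorm_pairingTerm_le (hβ : ∑' k, ‖β k‖ₑ ^ 2 ≠ ∞)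
    (hβn : ∀ k, ‖β (-k)‖ₑ = ‖β k‖ₑ) {B : ℝ≥0} (hw : ∀ k j, ‖w k j‖ₑ ≤ B)
    (hf : FibreSum β s f Gf) (hg : FibreSum β u g Gg) (hh : FibreSum β v h Gh) :
    ∃ M : ℝ≥0∞, M ≠ ∞ ∧
      ∀ k, ∑' p, ‖pairingTerm w s u v f g h k p‖ₑ ≤ M * ‖β k‖ₑ := by
  obtain ⟨Mf, hMf, hf⟩ := hf.bound
  obtain ⟨Mg, hMg, hg⟩ := hg.bound
  obtain ⟨Mh, hMh, hh⟩ := hh.bound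
  refine ⟨B * Mg * Mh * (Mf * ∑' k, ‖β k‖ₑ ^ 2), by finiteness, fun k => ?_⟩
  calc ∑' p, ‖pairingTerm w s u v f g h k p‖ₑ
      = ∑' x, ‖w k (s x)‖ₑ * ‖f x‖ₑ * ((∑' y, ‖if u y = -s x then g y else 0‖ₑ) *
          ∑' z, ‖if v z = k then h z else 0‖ₑ) := by
        rw [ENNReal.tsum_prod']
        refine tsum_congr fun x => ?_
        rw [ENNReal.tsum_prod']
        simp only [pairingTerm, enorm_mul, ENNReal.tsum_mul_left, ENNReal.tsum_mul_right]
    _ ≤ ∑' x, B * ‖f x‖ₑ * ((Mg * ‖β (s x)‖ₑ) * (Mh * ‖β k‖ₑ)) := by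
        refine ENNReal.tsum_le_tsum fun x => ?_
        gcongr
        · exact hw _ _
        · exact (hg _).trans_eq (by rw [hβn])
        · exact hh k
    _ = B * Mg * Mh * (∑' x, ‖f x‖ₑ * ‖β (s x)‖ₑ) * ‖β k‖ₑ := by
        rw [← ENNReal.tsum_mul_left, ← ENNReal.tsum_mul_right]
        refine tsum_congr fun x => ?_
        ring
    _ ≤ _ := by
        gcongr
        exact FibreSum.tsum_enorm_mul_le hf

/-- Absolute convergence permits evaluating the triple sum first over `Y × Z` for fixed `x`, then
over the fibres of `s`. -/
theorem exists_hasSum_pairingTerm (hβ : ∑' k, ‖β k‖ₑ ^ 2 ≠ ∞)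
    (hβn : ∀ k, ‖β (-k)‖ₑ = ‖β k‖ₑ) {B : ℝ≥0} (hw : ∀ k j, ‖w k j‖ₑ ≤ B)
    (hf : FibreSum β s f Gf) (hg : FibreSum β u g Gg) (hh : FibreSum β v h Gh) (k : ℤ) :
    ∃ c, HasSum (pairingTerm w s u v f g h k) c ∧
      HasSum (fun j => w k j * (Gf j * Gg (-j) * Gh k)) c := by
  obtain ⟨M, hM, hb⟩ := exists_tsum_enorm_pairingTerm_le hβ hβn hw hf hg hh
  have hs : Summable (pairingTerm w s u v f g h k) :=
    Summable.of_enorm (ne_top_of_le_ne_top (by finiteness) (hb k))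
  refine ⟨_, hs.hasSum, ?_⟩
  have h1 : HasSum (fun x => w k (s x) * f x * (Gg (-s x) * Gh k))
      (∑' p, pairingTerm w s u v f g h k p) := by
    refine hs.hasSum.prod_fiberwise fun x => ?_
    have h2 := hasSum_mul_prod (hg.hasSum (-s x)) (hh.hasSum k)
    exact h2.mul_left (w k (s x) * f x)
  refine hasSum_of_eq (h1.tsum_fiberwise s) (fun j => ?_) rfl
  rw [tsum_subtype (s ⁻¹' {j}) fun x => w k (s x) * f x * (Gg (-s x) * Gh k)]
  have e : (s ⁻¹' {j}).indicator (fun x => w k (s x) * f x * (Gg (-s x) * Gh k)) =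
      fun x => (w k j * (Gg (-j) * Gh k)) * (if s x = j then f x else 0) := by
    funext x
    by_cases hx : s x = j
    · rw [Set.indicator_of_mem (by exact hx), if_pos hx, hx]
      ring
    · rw [Set.indicator_of_notMem (by exact hx), if_neg hx, mul_zero]
  rw [e, tsum_mul_left, (hf.hasSum j).tsum_eq]
  ring

end

/-- The kernel `-i F°` at the frequencies `k / L` and `j / L`, extended by zero. -/
noncomputable def resonantKernel (L : ℝ) (k j : ℤ) : ℂ :=
  if k = 0 ∨ j = 0 then 0 else -Complex.I * Fexact (k / L) (j / L)

theorem exists_resonantKernel_le {L : ℝ} (hL : 0 < L) :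
    ∃ B : ℝ≥0, ∀ k j, ‖resonantKernel L k j‖ₑ ≤ B := by
  obtain ⟨B, hB, h⟩ := boundedKernel_Fexact hL
  lift B to ℝ≥0 using hB
  refine ⟨B, fun k j => ?_⟩
  rw [enorm_eq_nnnorm, ENNReal.coe_le_coe]
  refine NNReal.coe_le_coe.1 ?_
  rw [coe_nnnorm, resonantKernel]
  split_ifs with h0
  · simp
  · rw [not_or] at h0
    rw [norm_mul, norm_neg, Complex.norm_I, one_mul, Complex.norm_real]
    exact h ⟨k, h0.1⟩ ⟨j, h0.2⟩

/-! ### The tree sums on ternary trees. -/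

namespace PairTree

/-- The assignments of nonzero frequencies to the leaves. -/
def Config : PairTree → Type
  | leaf => NZ
  | graft _ _ t₁ t₂ t₃ => t₁.Config × t₂.Config × t₃.Config

/-- The total frequency. -/
def total : (t : PairTree) → t.Config → ℤ
  | leaf, x => x.1
  | graft _ _ t₁ t₂ t₃, x => t₁.total x.1 + (t₂.total x.2.1 + t₃.total x.2.2)

/-- The number of pairs of nodes. -/
def size : PairTree → ℕ
  | leaf => 0
  | graft _ _ t₁ t₂ t₃ => t₁.size + t₂.size + t₃.size + 1

variable (L : ℝ) (a : ℝ → ℝ)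

/-- The term of the tree sum at given leaf frequencies. -/
noncomputable def term : (t : PairTree) → t.Config → ℂ
  | leaf, x => fourierAt L a ((x.1 : ℤ) / L)
  | graft _ _ t₁ t₂ t₃, x =>
    pairFactor (t₁.total x.1 / L) (t₂.total x.2.1 / L) (t₃.total x.2.2 / L) *
      (t₁.term x.1 * (t₂.term x.2.1 * t₃.term x.2.2))

/-- The value of the unnormalised tree sum at total frequency `k / L`. -/
noncomputable def resonantValue (t : PairTree) (k : ℤ) : ℂ :=
  if k = 0 then 0 else (2 * Real.pi * L : ℝ) ^ t.size * (-Complex.I) ^ t.size *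
    t.coeff Fexact L a (k / L) * fourierAt L a (k / L)

variable {L a}

theorem term_eq_zero : ∀ (t : PairTree) (x : t.Config), t.total x = 0 → t.term L a x = 0
  | leaf, x, h => absurd h x.2
  | graft _ _ t₁ t₂ t₃, x, h => by
    have h' : ((t₁.total x.1 : ℤ) : ℝ) / L + (t₂.total x.2.1 / L + t₃.total x.2.2 / L) = 0 := by
      rw [← add_div, ← add_div, ← Int.cast_add, ← Int.cast_add, show
        t₁.total x.1 + (t₂.total x.2.1 + t₃.total x.2.2) = 0 from h, Int.cast_zero, zero_div]
    rw [term, pairFactor, h', omega_zero]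
    simp

section

variable (hL : 0 < L)
  (hq : ∀ p : Polynomial ℚ, p ≠ 0 → p.natDegree ≤ 2 → Polynomial.aeval (L ^ 2) p ≠ 0)

include hL hq in
theorem ite_term_graft (b : Bool) (i : ℕ) (t₁ t₂ t₃ : PairTree) (k : ℤ)
    (x : t₁.Config × t₂.Config × t₃.Config) :
    (if (graft b i t₁ t₂ t₃).total x = k then (graft b i t₁ t₂ t₃).term L a x else 0) =
      pairingTerm (resonantKernel L) t₁.total t₂.total t₃.total
        (t₁.term L a) (t₂.term L a) (t₃.term L a) k x +
      pairingTerm (resonantKernel L) t₁.total t₃.total t₂.total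
        (t₁.term L a) (t₃.term L a) (t₂.term L a) k (x.1, x.2.2, x.2.1) := by
  by_cases hk : k = 0
  · subst hk
    have e : (if (graft b i t₁ t₂ t₃).total x = 0 then (graft b i t₁ t₂ t₃).term L a x
        else 0) = 0 := by
      split_ifs with h
      · exact term_eq_zero (graft b i t₁ t₂ t₃) x h
      · rfl
    rw [e]
    simp [pairingTerm, resonantKernel]
  by_cases h₁ : t₁.total x.1 = 0
  · simp [pairingTerm, term, term_eq_zero t₁ x.1 h₁]
  have key := ite_pairFactor hL hq (k := k) (k₁ := t₁.total x.1) (k₂ := t₂.total x.2.1)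
    (k₃ := t₃.total x.2.2) hk h₁
  have e : (if (graft b i t₁ t₂ t₃).total x = k then (graft b i t₁ t₂ t₃).term L a x else 0) =
      (if t₁.total x.1 + (t₂.total x.2.1 + t₃.total x.2.2) = k then
        pairFactor (t₁.total x.1 / L) (t₂.total x.2.1 / L) (t₃.total x.2.2 / L) else 0) *
      (t₁.term L a x.1 * (t₂.term L a x.2.1 * t₃.term L a x.2.2)) := by
    rw [ite_mul, zero_mul]
    rfl
  rw [e, key]
  simp only [pairingTerm, resonantKernel, hk, h₁, or_self, if_false]
  rw [← mul_boole (t₂.total x.2.1 = -t₁.total x.1) (t₂.term L a x.2.1),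
    ← mul_boole (t₃.total x.2.2 = -t₁.total x.1) (t₃.term L a x.2.2),
    ← mul_boole (t₂.total x.2.1 = k) (t₂.term L a x.2.1),
    ← mul_boole (t₃.total x.2.2 = k) (t₃.term L a x.2.2)]
  ring

variable (hb : Summable fun j : ℤ => ‖fourierAt L a (j / L)‖ ^ 2)

theorem fibreSum_leaf : FibreSum (fun k : ℤ => fourierAt L a (k / L)) leaf.total
    (leaf.term L a) (leaf.resonantValue L a) := by
  refine ⟨fun k => ?_, 1, ENNReal.one_ne_top, fun k => ?_⟩
  · by_cases hk : k = 0
    · refine hasSum_of_eq hasSum_zero (fun x : NZ => if_neg fun h => x.2 (h.trans hk)) ?_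
      rw [resonantValue, if_pos hk]
    · refine hasSum_of_eq (hasSum_ite_eq (⟨k, hk⟩ : NZ) (fourierAt L a (k / L)))
        (fun x : NZ => ?_) ?_
      · by_cases hx : x = ⟨k, hk⟩
        · subst hx
          rw [if_pos rfl]
          exact if_pos rfl
        · rw [if_neg hx]
          exact if_neg fun h => hx (Subtype.ext h)
      · rw [resonantValue, if_neg hk]
        simp [size, coeff]
  · rw [one_mul]
    change ∑' x : NZ, ‖if (x : ℤ) = k then fourierAt L a ((x : ℤ) / L) else 0‖ₑ ≤ _
    by_cases hk : k = 0
    · refine le_of_eq_of_le (ENNReal.tsum_eq_zero.2 fun x => ?_) zero_le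
      rw [if_neg fun h => x.2 (h.trans hk), enorm_zero]
    · rw [tsum_eq_single (⟨k, hk⟩ : NZ) fun x hx => by
        rw [if_neg fun h => hx (Subtype.ext h), enorm_zero], if_pos rfl]

include hb in
theorem tsum_enorm_fourierAt_sq_ne_top :
    ∑' k : ℤ, ‖fourierAt L a (k / L)‖ₑ ^ 2 ≠ ∞ := by
  have h : Summable fun j : ℤ => ‖fourierAt L a (j / L) ^ 2‖ := by simpa only [norm_pow] using hb
  have h' := tsum_enorm_ne_top_iff_summable_norm.2 h
  simpa only [enorm_pow] using h'

theorem enorm_fourierAt_neg (k : ℤ) :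
    ‖fourierAt L a (((-k : ℤ) : ℝ) / L)‖ₑ = ‖fourierAt L a ((k : ℝ) / L)‖ₑ := by
  rw [Int.cast_neg, neg_div, enorm_eq_nnnorm, enorm_eq_nnnorm]
  congr 1
  exact NNReal.eq (norm_fourierAt_neg _)

-- The identity `â(η) â(-η) = |â(η)|²` turns the product of subtree values into one step of the
-- coefficient recursion; the new vertex accounts for the extra factors `2πL` and `-i`.
include hL hb in
theorem hasSum_resonantValue (b : Bool) (i : ℕ) (t₁ t₂ t₃ : PairTree) (k : ℤ) :
    HasSum (fun j : ℤ =>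
      resonantKernel L k j * (t₁.resonantValue L a j * t₂.resonantValue L a (-j) *
        t₃.resonantValue L a k) +
      resonantKernel L k j * (t₁.resonantValue L a j * t₃.resonantValue L a (-j) *
        t₂.resonantValue L a k)) ((graft b i t₁ t₂ t₃).resonantValue L a k) := by
  by_cases hk : k = 0
  · refine hasSum_of_eq hasSum_zero (fun j => ?_) (by rw [resonantValue, if_pos hk])
    simp [resonantKernel, hk]
  have hb' : Summable fun j : NZ => ‖fourierAt L a ((j : ℤ) / L)‖ ^ 2 := hb.subtype _
  have hw := boundedKernel_Fexact hL
  have h := hasSum_coeffStep hb' hw (t₁.boundedOnLattice_coeff hb' hw)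
    (t₂.boundedOnLattice_coeff hb' hw) (t₃.boundedOnLattice_coeff hb' hw) ⟨k, hk⟩
  have h' := ((Complex.hasSum_ofReal.2 h).mul_left
    (((2 * Real.pi * L : ℝ) : ℂ) ^ (graft b i t₁ t₂ t₃).size *
      (-Complex.I) ^ (graft b i t₁ t₂ t₃).size)).mul_right (fourierAt L a (k / L))
  refine (hasSum_subtype_iff_of_support_subset (s := {j : ℤ | j ≠ 0}) ?_).1
    (hasSum_of_eq h' (fun j : NZ => ?_)
      (by rw [resonantValue, if_neg hk]; rfl))
  · intro j hj hj0
    refine hj ?_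
    simp [resonantKernel, hj0]
  · obtain ⟨j, hj⟩ := j
    have hP : ((2 * Real.pi * L : ℝ) : ℂ) ≠ 0 := by
      exact_mod_cast (by positivity : (0 : ℝ) < 2 * Real.pi * L).ne'
    simp only [Function.comp_apply, resonantKernel, resonantValue, hk, hj, neg_eq_zero, or_self,
      if_false, size, pow_one, pow_add]
    generalize 2 * Real.pi * L = P at hP ⊢
    have hn : (((-j : ℤ) : ℝ)) / L = -((j : ℝ) / L) := by push_cast; ring
    have hc := fourierAt_mul_neg (L := L) (a := a) ((j : ℝ) / L)
    rw [hn, Complex.ofReal_mul, Complex.ofReal_mul, ← hc, Complex.ofReal_div,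
      Complex.ofReal_one]
    push_cast
    field_simp
    ring

include hL hq hb in
theorem fibreSum_term : ∀ t : PairTree, FibreSum (fun k : ℤ => fourierAt L a (k / L)) t.total
    (t.term L a) (t.resonantValue L a)
  | leaf => fibreSum_leaf
  | graft b i t₁ t₂ t₃ => by
    have f₁ := fibreSum_term t₁
    have f₂ := fibreSum_term t₂
    have f₃ := fibreSum_term t₃
    have hβ := tsum_enorm_fourierAt_sq_ne_top hb
    obtain ⟨B, hB⟩ := exists_resonantKernel_le hL
    let e : t₁.Config × t₂.Config × t₃.Config ≃ t₁.Config × t₃.Config × t₂.Config :=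
      Equiv.prodCongr (Equiv.refl _) (Equiv.prodComm _ _)
    constructor
    · intro k
      obtain ⟨c, hc, hc'⟩ := exists_hasSum_pairingTerm hβ enorm_fourierAt_neg hB f₁ f₂ f₃ k
      obtain ⟨d, hd, hd'⟩ := exists_hasSum_pairingTerm hβ enorm_fourierAt_neg hB f₁ f₃ f₂ k
      have hcd := (hc'.add hd').unique (hasSum_resonantValue hL hb b i t₁ t₂ t₃ k)
      exact hasSum_of_eq (hc.add (e.hasSum_iff.2 hd))
        (fun x => ite_term_graft hL hq b i t₁ t₂ t₃ k x) hcd.symm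
    · obtain ⟨M, hM, h⟩ := exists_tsum_enorm_pairingTerm_le hβ enorm_fourierAt_neg hB f₁ f₂ f₃
      obtain ⟨N, hN, h'⟩ := exists_tsum_enorm_pairingTerm_le hβ enorm_fourierAt_neg hB f₁ f₃ f₂
      refine ⟨M + N, by finiteness, fun k => ?_⟩
      rw [add_mul]
      refine le_trans ?_ (add_le_add (h k) (h' k))
      rw [← e.tsum_eq, ← ENNReal.tsum_add]
      refine ENNReal.tsum_le_tsum fun x => ?_
      exact (congrArg enorm (ite_term_graft hL hq b i t₁ t₂ t₃ k x)).trans_le (enorm_add_le _ _)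

end

end PairTree

/-! ### Transfer to the binary trees. -/

theorem sum_leaf_node {M : Type*} [AddCommMonoid M] (l r : BinaryTree Unit)
    (f : Leaf (.node () l r) → M) :
    ∑ i, f i = ∑ i : Leaf l, f (.inl i) + ∑ i : Leaf r, f (.inr i) :=
  Fintype.sum_sum_type (α₁ := Leaf l) (α₂ := Leaf r) f

theorem prod_leaf_node {M : Type*} [CommMonoid M] (l r : BinaryTree Unit)
    (f : Leaf (.node () l r) → M) :
    ∏ i, f i = (∏ i : Leaf l, f (.inl i)) * ∏ i : Leaf r, f (.inr i) :=
  Fintype.prod_sum_type (α₁ := Leaf l) (α₂ := Leaf r) f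

theorem sum_leaf_nil {M : Type*} [AddCommMonoid M] (f : Leaf .nil → M) : ∑ i, f i = f () :=
  Fintype.sum_unique (ι := Unit) f

theorem prod_leaf_nil {M : Type*} [CommMonoid M] (f : Leaf .nil → M) : ∏ i, f i = f () :=
  Fintype.prod_unique (ι := Unit) f

/-- The factor of a tree term at the lower node `m` and the upper node `m'` of a pair. -/
noncomputable def pairValue (A : BinaryTree Unit) (y : Leaf A → ℝ) (m m' : Node A) : ℂ :=
  (nodeOmega A y m' * nodeOmega A y m : ℂ) / (Complex.I * nodeDelta A y m) *
    (if nodeDelta A y m + nodeDelta A y m' = 0 then 1 else 0)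

theorem pairValue_right (A₁ A₂ A₃ : BinaryTree Unit)
    (y : Leaf (.node () A₁ (.node () A₂ A₃)) → ℝ) :
    pairValue _ y (some (.inr none)) none = pairFactor (∑ i : Leaf A₁, y (.inl i))
      (∑ i : Leaf A₂, y (.inr (.inl i))) (∑ i : Leaf A₃, y (.inr (.inr i))) := by
  simp only [pairValue, pairFactor, nodeOmega, nodeDelta, sum_leaf_node]

theorem pairValue_left (A₁ A₂ A₃ : BinaryTree Unit)
    (y : Leaf (.node () (.node () A₂ A₃) A₁) → ℝ) :
    pairValue _ y (some (.inl none)) none = pairFactor (∑ i : Leaf A₁, y (.inr i))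
      (∑ i : Leaf A₂, y (.inl (.inl i))) (∑ i : Leaf A₃, y (.inl (.inr i))) := by
  simp only [pairValue, pairFactor, nodeOmega, nodeDelta, sum_leaf_node]
  rw [Delta_comm (_ + _ + _), add_comm (_ + _) (∑ i : Leaf A₁, y (.inr i))]

namespace PairTree

/-- The leaf frequencies of the binary tree, rearranged along the ternary tree. -/
def configEquiv : (t : PairTree) → (Leaf t.toTree → NZ) ≃ t.Config
  | leaf => Equiv.funUnique Unit NZ
  | graft true _ t₁ t₂ t₃ =>
    (Equiv.sumArrowEquivProdArrow (Leaf t₁.toTree) (Leaf t₂.toTree ⊕ Leaf t₃.toTree) NZ).trans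
      (Equiv.prodCongr t₁.configEquiv
        ((Equiv.sumArrowEquivProdArrow (Leaf t₂.toTree) (Leaf t₃.toTree) NZ).trans
          (Equiv.prodCongr t₂.configEquiv t₃.configEquiv)))
  | graft false _ t₁ t₂ t₃ =>
    ((Equiv.sumArrowEquivProdArrow (Leaf t₂.toTree ⊕ Leaf t₃.toTree) (Leaf t₁.toTree) NZ).trans
      (Equiv.prodComm _ _)).trans
      (Equiv.prodCongr t₁.configEquiv
        ((Equiv.sumArrowEquivProdArrow (Leaf t₂.toTree) (Leaf t₃.toTree) NZ).trans
          (Equiv.prodCongr t₂.configEquiv t₃.configEquiv)))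

theorem total_configEquiv : ∀ (t : PairTree) (x : Leaf t.toTree → NZ),
    t.total (t.configEquiv x) = ∑ l, (x l : ℤ)
  | leaf, x => (sum_leaf_nil fun l => (x l : ℤ)).symm
  | graft true _ t₁ t₂ t₃, x => by
    refine Eq.trans ?_ (sum_leaf_node _ _ _).symm
    rw [sum_leaf_node, ← total_configEquiv t₁, ← total_configEquiv t₂, ← total_configEquiv t₃]
    rfl
  | graft false _ t₁ t₂ t₃, x => by
    refine Eq.trans ?_ (sum_leaf_node _ _ _).symm
    rw [sum_leaf_node, ← total_configEquiv t₁, ← total_configEquiv t₂, ← total_configEquiv t₃,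
      add_comm]
    rfl

variable (L : ℝ) (a : ℝ → ℝ)

theorem sum_freq (t : PairTree) (x : Leaf t.toTree → NZ) :
    ∑ l, ((x l : ℤ) : ℝ) / L = t.total (t.configEquiv x) / L := by
  rw [total_configEquiv, ← Finset.sum_div, Int.cast_sum]

theorem pairProd_mul_prod_leaf : ∀ (t : PairTree) (x : Leaf t.toTree → NZ),
    t.pairProd (pairValue t.toTree fun l => ((x l : ℤ) : ℝ) / L) *
      ∏ l, fourierAt L a (((x l : ℤ) : ℝ) / L) = t.term L a (t.configEquiv x)
  | leaf, x => (one_mul _).trans (prod_leaf_nil _)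
  | graft true j t₁ t₂ t₃, x => by
    have e₁ := pairProd_mul_prod_leaf t₁ fun l => x (.inl l)
    have e₂ := pairProd_mul_prod_leaf t₂ fun l => x (.inr (.inl l))
    have e₃ := pairProd_mul_prod_leaf t₃ fun l => x (.inr (.inr l))
    have s₁ := sum_freq L t₁ fun l => x (.inl l)
    have s₂ := sum_freq L t₂ fun l => x (.inr (.inl l))
    have s₃ := sum_freq L t₃ fun l => x (.inr (.inr l))
    have hp : (graft true j t₁ t₂ t₃).pairProd (pairValue _ fun l => ((x l : ℤ) : ℝ) / L) =
        pairFactor (∑ l, ((x (.inl l) : ℤ) : ℝ) / L) (∑ l, ((x (.inr (.inl l)) : ℤ) : ℝ) / L)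
          (∑ l, ((x (.inr (.inr l)) : ℤ) : ℝ) / L) *
        (t₁.pairProd (pairValue t₁.toTree fun l => ((x (.inl l) : ℤ) : ℝ) / L) *
        t₂.pairProd (pairValue t₂.toTree fun l => ((x (.inr (.inl l)) : ℤ) : ℝ) / L) *
        t₃.pairProd (pairValue t₃.toTree fun l => ((x (.inr (.inr l)) : ℤ) : ℝ) / L)) :=
      congrArg (· * _) (pairValue_right _ _ _ _)
    refine (congrArg₂ (· * ·) hp ((prod_leaf_node _ _ _).trans (congrArg (_ * ·) (prod_leaf_node _ _ _)))).trans ?_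
    rw [s₁, s₂, s₃]
    refine Eq.trans ?_ (congrArg (pairFactor
      (t₁.total (t₁.configEquiv fun l => x (.inl l)) / L)
      (t₂.total (t₂.configEquiv fun l => x (.inr (.inl l))) / L)
      (t₃.total (t₃.configEquiv fun l => x (.inr (.inr l))) / L) * ·) (congrArg₂ (· * ·) e₁
      (congrArg₂ (· * ·) e₂ e₃)))
    ring
  | graft false j t₁ t₂ t₃, x => by
    have e₁ := pairProd_mul_prod_leaf t₁ fun l => x (.inr l)
    have e₂ := pairProd_mul_prod_leaf t₂ fun l => x (.inl (.inl l))
    have e₃ := pairProd_mul_prod_leaf t₃ fun l => x (.inl (.inr l))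
    have s₁ := sum_freq L t₁ fun l => x (.inr l)
    have s₂ := sum_freq L t₂ fun l => x (.inl (.inl l))
    have s₃ := sum_freq L t₃ fun l => x (.inl (.inr l))
    have hp : (graft false j t₁ t₂ t₃).pairProd (pairValue _ fun l => ((x l : ℤ) : ℝ) / L) =
        pairFactor (∑ l, ((x (.inr l) : ℤ) : ℝ) / L) (∑ l, ((x (.inl (.inl l)) : ℤ) : ℝ) / L)
          (∑ l, ((x (.inl (.inr l)) : ℤ) : ℝ) / L) *
        (t₁.pairProd (pairValue t₁.toTree fun l => ((x (.inr l) : ℤ) : ℝ) / L) *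
        t₂.pairProd (pairValue t₂.toTree fun l => ((x (.inl (.inl l)) : ℤ) : ℝ) / L) *
        t₃.pairProd (pairValue t₃.toTree fun l => ((x (.inl (.inr l)) : ℤ) : ℝ) / L)) :=
      congrArg (· * _) (pairValue_left _ _ _ _)
    refine (congrArg₂ (· * ·) hp ((prod_leaf_node _ _ _).trans (congrArg (· * _) (prod_leaf_node _ _ _)))).trans ?_
    rw [s₁, s₂, s₃]
    refine Eq.trans ?_ (congrArg (pairFactor
      (t₁.total (t₁.configEquiv fun l => x (.inr l)) / L)
      (t₂.total (t₂.configEquiv fun l => x (.inl (.inl l))) / L)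
      (t₃.total (t₃.configEquiv fun l => x (.inl (.inr l))) / L) * ·) (congrArg₂ (· * ·) e₁
      (congrArg₂ (· * ·) e₂ e₃)))
    ring

theorem size_eq_card_labels (t : PairTree) (ht : t.Decreasing) : t.size = t.labels.card := by
  have h : ∀ t : PairTree, t.toTree.numNodes = 2 * t.size := fun t => by
    induction t with
    | leaf => rfl
    | graft b j t₁ t₂ t₃ h₁ h₂ h₃ =>
      cases b <;> simp only [toTree, BinaryTree.numNodes, size] <;> omega
  have := t.card_labels ht
  rw [h] at this
  omega

/-- The term of an ordered tree is the term of the corresponding labelled ternary tree. -/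
theorem treeTerm_eq {n : ℕ} {t : PairTree} (ht : t.Decreasing) (hl : t.labels = range n)
    (σ : Fin (2 * n) ≃ Node t.toTree) (h : ∀ m, t.rank m = σ.symm m)
    (x : Leaf t.toTree → NZ) :
    treeTerm L a ⟨t.toTree, σ⟩ x = t.term L a (t.configEquiv x) := by
  rw [← pairProd_mul_prod_leaf, ← prod_pairAt t _ ht, hl, Finset.prod_range]
  refine congrArg (· * _) (prod_congr rfl fun j _ => ?_)
  obtain ⟨m, m', hm, hm', -, hg⟩ := t.exists_pair (M := ℂ) ht j (by rw [hl]; simp)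
  have e : σ ⟨2 * j, by omega⟩ = m := by
    rw [← Equiv.eq_symm_apply]; exact Fin.ext (hm.symm.trans (h m))
  have e' : σ ⟨2 * j + 1, by omega⟩ = m' := by
    rw [← Equiv.eq_symm_apply]; exact Fin.ext (hm'.symm.trans (h m'))
  rw [hg, ← e, ← e']
  rfl

end PairTree

open PairTree in
theorem hasSum_treeTerm {L : ℝ} {a : ℝ → ℝ} (hL : 0 < L)
    (hq : ∀ p : Polynomial ℚ, p ≠ 0 → p.natDegree ≤ 2 → Polynomial.aeval (L ^ 2) p ≠ 0)
    (hb : Summable fun j : ℤ => ‖fourierAt L a (j / L)‖ ^ 2) {n : ℕ}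
    {p : Σ A : BinaryTree Unit, Fin (2 * n) ≃ Node A} (hp : p ∈ pairedTrees n) {k : ℤ}
    (hk : k ≠ 0) :
    HasSum (fun x : {x : Leaf p.1 → NZ // ∑ l, (x l : ℤ) = k} => treeTerm L a p x.1)
      ((2 * Real.pi * L : ℝ) ^ n * (-Complex.I) ^ n *
        treeCoeff Fexact L a p (k / L) * fourierAt L a (k / L)) := by
  obtain ⟨t, ht, hl, he⟩ := exists_pairTree_of_mem_pairedTrees hp
  have hc := congrFun (rankedCoeff_toRanked Fexact L a t ht) (k / L)
  rw [he] at hc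
  have hn : t.size = n := by rw [size_eq_card_labels t ht, hl, card_range]
  obtain ⟨A, σ⟩ := p
  obtain ⟨rfl, hρ⟩ := Sigma.mk.inj_iff.1 he
  have hs := (fibreSum_term hL hq hb t).hasSum k
  rw [resonantValue, if_neg hk, ← hc, hn] at hs
  rw [← t.configEquiv.hasSum_iff] at hs
  refine (hasSum_subtype_iff_indicator
    (f := treeTerm L a ⟨t.toTree, σ⟩)
    (s := {x : Leaf t.toTree → NZ | ∑ l, (x l : ℤ) = k})).2 (hasSum_of_eq hs (fun x => ?_) rfl)
  rw [Function.comp_apply, total_configEquiv,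
    ← treeTerm_eq L a ht hl σ (congrFun (eq_of_heq hρ)), Set.indicator_apply]
  rfl

end BBM

theorem mainTheorem3 :
    ∃ C : ℝ, 0 < C ∧ ∀ L : ℝ, 0 < L →
      (∀ p : Polynomial ℚ, p ≠ 0 → p.natDegree ≤ 2 → Polynomial.aeval (L ^ 2) p ≠ 0) →
      ∀ a : ℝ → ℝ, Function.Periodic a (2 * Real.pi * L) →
      MeasureTheory.MemLp a 2
        (MeasureTheory.volume.restrict (Set.Ioc 0 (2 * Real.pi * L))) →
      (∫ x in (0 : ℝ)..(2 * Real.pi * L), a x) = 0 →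
      ∀ (k : ℤ) (ξ : ℝ), k ≠ 0 → ξ = k / L →
        -- the coefficients defined by the recursion with kernel `F`
        (∀ n : ℕ, ∑ p ∈ BBM.pairedTrees n, BBM.treeCoeff BBM.F L a p ξ = BBM.U L a ξ ^ n) ∧
        HasSum (fun j : BBM.NZ => 2 / (Real.pi * L) *
          (‖BBM.fourierAt L a ((j : ℤ) / L)‖ ^ 2 * BBM.F ξ ((j : ℤ) / L))) (BBM.U L a ξ) ∧
        HasSum (fun j : BBM.NZ => 2 / (Real.pi * L) *
          (‖BBM.fourierAt L a ((j : ℤ) / L)‖ ^ 2 * BBM.Ftilde ξ ((j : ℤ) / L))) (BBM.U L a ξ) ∧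
        Real.sqrt (1 + ξ ^ 2) * |BBM.U L a ξ| ≤
          C * (∫ x in (0 : ℝ)..(2 * Real.pi * L), a x ^ 2) / L ∧
        -- the exact coefficients of the tree sums, where coinciding pairings count once
        (∀ n : ℕ, ∀ p ∈ BBM.pairedTrees n,
          Summable (fun x : {x : BBM.Leaf p.1 → BBM.NZ // ∑ l, (x l : ℤ) = k} =>
            BBM.treeTerm L a p x.1) ∧
          BBM.treeSum L a p k =
            (-Complex.I) ^ n * (BBM.treeCoeff BBM.Fexact L a p ξ : ℂ) * BBM.fourierAt L a ξ) ∧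
        (∀ n : ℕ, ∑ p ∈ BBM.pairedTrees n, BBM.treeCoeff BBM.Fexact L a p ξ =
          BBM.Uexact L a ξ ^ n) ∧
        |ξ| * |BBM.Uexact L a ξ| ≤ C * (∫ x in (0 : ℝ)..(2 * Real.pi * L), a x ^ 2) / L := by
  -- The constant is dictated by the bound for `Uexact`; the one for `U` needs only `8/π`.
  refine ⟨10, by norm_num, ?_⟩
  rintro L hL hq a - ha - k _ hk rfl
  have hsum := BBM.hasSum_norm_fourierAt_sq hL ha
  obtain ⟨hb, hN⟩ := BBM.summable_nz_of_hasSum hsum fun _ => sq_nonneg _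
  have hN0 := (tsum_nonneg fun j : BBM.NZ => sq_nonneg ‖BBM.fourierAt L a ((j : ℤ) / L)‖).trans hN
  refine ⟨fun n => ?_, BBM.hasSum_U_F hL hb _, BBM.hasSum_U_Ftilde hb _, ?_, fun n p hp => ?_,
    fun n => ?_, BBM.abs_mul_abs_Uexact_le hL hb hN ⟨k, hk⟩⟩
  · have h := BBM.PairTree.sum_coeff hb (BBM.boundedKernel_F hL) (fun k => BBM.hasSum_U_F hL hb _)
      (fun k => BBM.U_neg _) n (Finset.range n) subset_rfl ⟨k, hk⟩
    rw [Finset.card_range] at h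
    rw [BBM.PairTree.sum_treeCoeff]
    exact h
  · refine (BBM.sqrt_mul_abs_U_le hL hb hN _).trans ?_
    gcongr
    rw [div_le_iff₀ Real.pi_pos]
    linarith [Real.pi_gt_three]
  · have h := BBM.hasSum_treeTerm hL hq hsum.summable hp hk
    refine ⟨h.summable, ?_⟩
    have hP : ((2 * Real.pi * L : ℝ) : ℂ) ≠ 0 := by
      exact_mod_cast (by positivity : (0 : ℝ) < 2 * Real.pi * L).ne'
    rw [BBM.treeSum, h.tsum_eq]
    generalize 2 * Real.pi * L = P at hP ⊢
    push_cast
    field_simp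
  · have h := BBM.PairTree.sum_coeff hb (BBM.boundedKernel_Fexact hL)
      (fun k => BBM.hasSum_Uexact hL hb k) (fun k => BBM.Uexact_neg _) n (Finset.range n)
      subset_rfl ⟨k, hk⟩
    rw [Finset.card_range] at h
    rw [BBM.PairTree.sum_treeCoeff]
    exact h
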